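/- **Setting.** Let $\mathcal H$ be a separable complex Hilbert space. A state on $\mathcal H$ is a positive operator of trace one. Let $\mathcal Y$ be a standard Borel space with a $\sigma$-finite measure $\mu$, and let $M(dy)=m(y)\,\mu(dy)$ be a POVM on $\mathcal H$ with a bounded operator density: $y\mapsto m(y)$ is a (weakly) measurable family of positive operators with $\|m(y)\|\le b<\infty$ for all $y$ and $\int_{\mathcal Y} m(y)\,\mu(dy)=I$ in the weak sense. For a state $\rho$ put $p_\rho(y)=\operatorname{Tr}\rho\, m(y)$ and $$h_M(\rho)=-\int_{\mathcal Y} p_\rho(y)\log p_\rho(y)\,\mu(dy)\in(-\infty,+\infty].$$ An ensemble consists of a probability measure $\pi$ on a standard Borel space $\mathcal X$ and a measurable family $x\mapsto\rho(x)$ of states; its average state is $\int_{\mathcal X}\rho(x)\,\pi(dx)$. The convex closure of $h_M$ is $$e_M(\rho)=\inf\Big\{\int_{\mathcal X} h_M(\rho(x))\,\pi(dx)\;:\;\int_{\mathcal X}\rho(x)\,\pi(dx)=\rho\Big\},$$ the infimum being over all ensembles with average state $\rho$. For two such POVMs $M_1(dy_1)=m_1(y_1)\mu_1(dy_1)$ on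 $\mathcal H_1$ and $M_2(dy_2)=m_2(y_2)\mu_2(dy_2)$ on $\mathcal H_2$, $M_1\otimes M_2$ is the POVM on the Hilbert space tensor product $\mathcal H_1\otimes\mathcal H_2$ with density $m_1(y_1)\otimes m_2(y_2)$ with respect to $\mu_1\times\mu_2$. **Lemma.** 1. $e_M(\rho)>-\infty$ for every state $\rho$, and $e_M$ is convex: $e_M(t\rho+(1-t)\sigma)\le t\,e_M(\rho)+(1-t)\,e_M(\sigma)$ for all states $\rho,\sigma$ on $\mathcal H$ and $t\in[0,1]$ (with $0\cdot\infty=0$). 2. $e_M$ is lower semicontinuous on the set of states with respect to the trace norm $\|\cdot\|_1$. 3. Strong superadditivity: for every state $\rho_{12}$ on $\mathcal H_1\otimes\mathcal H_2$ with partial states $\rho_1=\operatorname{Tr}_2\rho_{12}$ and $\rho_2=\operatorname{Tr}_1\rho_{12}$, $$e_{M_1\otimes M_2}(\rho_{12})\ge e_{M_1}(\rho_1)+e_{M_2}(\rho_2).$$ 4. Additivity: for all states $\rho_1$ on $\mathcal H_1$ and $\rho_2$ on $\mathcal H_2$, $$e_{M_1\otimes M_2}(\rho_1\otimes\rho_2)=e_{M_1}(\rho_1)+e_{M_2}(\rho_2).$$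 -/

import Mathlib

open MeasureTheory TensorProduct
open scoped InnerProductSpace ENNReal

noncomputable section

namespace MeasChannel

/-! ### Trace, density operators and the trace norm on a Hilbert space -/

section Trace

variable (H : Type*) [NormedAddCommGroup H] [InnerProductSpace ℂ H] [CompleteSpace H]

/-- Index set of a fixed orthonormal (Hilbert) basis of `H`. -/
def basisSet : Set H := (exists_hilbertBasis ℂ H).choose

/-- A fixed Hilbert basis of `H`. None of the notions below depends on the choice. -/
def onb : HilbertBasis (basisSet H) ℂ H := (exists_hilbertBasis ℂ H).choose_spec.choose

variable {H}

/-- `Tr T = ∑ᵢ ⟨eᵢ, T eᵢ⟩` (used for trace-class operators, where the series converges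
absolutely). -/
def trace (T : H →L[ℂ] H) : ℂ := ∑' i, ⟪onb H i, T (onb H i)⟫_ℂ

/-- Density operators (quantum states): positive operators of trace one. -/
structure IsState (ρ : H →L[ℂ] H) : Prop where
  isPositive : ρ.IsPositive
  hasSum_trace : HasSum (fun i => ⟪onb H i, ρ (onb H i)⟫_ℂ) 1

/-- The trace norm `‖T‖₁ = Tr |T|`, `|T| = √(T* T)`, with values in `[0, ∞]`. -/
def traceNorm (T : H →L[ℂ] H) : ℝ≥0∞ :=
  ∑' i, ENNReal.ofReal (⟪onb H i, CFC.abs T (onb H i)⟫_ℂ).re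

end Trace

/-! ### Hilbert space tensor products -/

section Tensor

variable (H₁ H₂ : Type*)
  [NormedAddCommGroup H₁] [InnerProductSpace ℂ H₁] [CompleteSpace H₁]
  [NormedAddCommGroup H₂] [InnerProductSpace ℂ H₂] [CompleteSpace H₂]

/-- The Hilbert space tensor product: the completion of the algebraic tensor product with respect
to `⟨x ⊗ y, x' ⊗ y'⟩ = ⟨x, x'⟩ ⟨y, y'⟩`. -/
abbrev HTensor : Type _ := UniformSpace.Completion (H₁ ⊗[ℂ] H₂)

variable {H₁ H₂}

/-- The bounded operator `A ⊗ B` on `H₁ ⊗ H₂`. -/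
def opTensor (A : H₁ →L[ℂ] H₁) (B : H₂ →L[ℂ] H₂) : HTensor H₁ H₂ →L[ℂ] HTensor H₁ H₂ :=
  (TensorProduct.mapL A B).completion

/-- The bounded operator `x ↦ x ⊗ f` from `H₁` to `H₁ ⊗ H₂`. -/
def tensorRight (f : H₂) : H₁ →L[ℂ] HTensor H₁ H₂ :=
  UniformSpace.Completion.toComplL ∘L (TensorProduct.mkL ℂ H₁ H₂).flip f

/-- The bounded operator `y ↦ e ⊗ y` from `H₂` to `H₁ ⊗ H₂`. -/
def tensorLeft (e : H₁) : H₂ →L[ℂ] HTensor H₁ H₂ :=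
  UniformSpace.Completion.toComplL ∘L TensorProduct.mkL ℂ H₁ H₂ e

/-- The partial trace `Tr₂ T = ∑ⱼ (I ⊗ ⟨fⱼ|) T (I ⊗ |fⱼ⟩)` over the second factor, for `(fⱼ)` an
orthonormal basis of `H₂`. -/
def partialTraceSnd (T : HTensor H₁ H₂ →L[ℂ] HTensor H₁ H₂) : H₁ →L[ℂ] H₁ :=
  ∑' j, (tensorRight (onb H₂ j)).adjoint ∘L T ∘L tensorRight (onb H₂ j)

/-- The partial trace `Tr₁ T = ∑ᵢ (⟨eᵢ| ⊗ I) T (|eᵢ⟩ ⊗ I)` over the first factor, for `(eᵢ)` an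
orthonormal basis of `H₁`. -/
def partialTraceFst (T : HTensor H₁ H₂ →L[ℂ] HTensor H₁ H₂) : H₂ →L[ℂ] H₂ :=
  ∑' i, (tensorLeft (onb H₁ i)).adjoint ∘L T ∘L tensorLeft (onb H₁ i)

end Tensor

/-! ### Measurement channels with a bounded operator density -/

/-- The integral of an extended-real function, `∫ f⁺ - ∫ f⁻ ∈ [-∞, ∞]`. It is only used below
for functions whose negative part has a finite integral. -/
def extIntegral {X : Type*} [MeasurableSpace X] (μ : Measure X) (f : X → EReal) : EReal :=
  ((∫⁻ x, (f x).toENNReal ∂μ : ℝ≥0∞) : EReal) - ((∫⁻ x, (-f x).toENNReal ∂μ : ℝ≥0∞) : EReal)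

section Channel

variable {H : Type*} [NormedAddCommGroup H] [InnerProductSpace ℂ H] [CompleteSpace H]
  {Y : Type*} [MeasurableSpace Y]

/-- `m` is the operator density, bounded by `b`, of an observable (POVM) `M(dy) = m(y) μ(dy)`
on `H` with outcomes in `Y`: a measurable field of positive operators with `‖m(y)‖ ≤ b` and
`M(Y) = ∫ m(y) μ(dy) = I`, the integral being understood weakly. -/
structure IsPOVMDensity (μ : Measure Y) (m : Y → H →L[ℂ] H) (b : ℝ) : Prop where
  measurable : ∀ φ ψ : H, Measurable fun y => ⟪φ, m y ψ⟫_ℂ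
  isPositive : ∀ y, (m y).IsPositive
  norm_le : ∀ y, ‖m y‖ ≤ b
  lintegral_eq : ∀ φ : H,
    ∫⁻ y, ENNReal.ofReal (⟪φ, m y φ⟫_ℂ).re ∂μ = ENNReal.ofReal (‖φ‖ ^ 2)

/-- The output probability density `p_ρ(y) = Tr ρ m(y)`. -/
def outDensity (m : Y → H →L[ℂ] H) (ρ : H →L[ℂ] H) (y : Y) : ℝ := (trace (ρ ∘L m y)).re

/-- The output differential entropy `h_M(ρ) = -∫ p_ρ(y) log p_ρ(y) μ(dy)`. -/
def outEntropy (μ : Measure Y) (m : Y → H →L[ℂ] H) (ρ : H →L[ℂ] H) : EReal :=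
  extIntegral μ fun y => (Real.negMulLog (outDensity m ρ y) : EReal)

variable (H) in
/-- An ensemble of states on `H`: a probability measure `π` on a standard Borel space and a
measurable family of density operators. (Every standard Borel space is isomorphic to one in the
lowest universe.) -/
structure Ensemble where
  X : Type
  measurableSpace : MeasurableSpace X
  standardBorel : StandardBorelSpace X
  π : Measure X
  isProbabilityMeasure : IsProbabilityMeasure π
  ρ : X → H →L[ℂ] H
  isState : ∀ x, IsState (ρ x)
  measurable : ∀ φ ψ : H, Measurable fun x => ⟪φ, ρ x ψ⟫_ℂ

attribute [instance] Ensemble.measurableSpace Ensemble.standardBorel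
  Ensemble.isProbabilityMeasure

/-- `σ` is the average state (barycenter) `∫ ρ(x) π(dx)` of the ensemble, the integral being
identified through its matrix elements. -/
def Ensemble.HasAverage (E : Ensemble H) (σ : H →L[ℂ] H) : Prop :=
  ∀ φ ψ : H, ⟪φ, σ ψ⟫_ℂ = ∫ x, ⟪φ, E.ρ x ψ⟫_ℂ ∂E.π

/-- The convex closure of the output differential entropy: the infimum of `∫ h_M(ρ(x)) π(dx)` over
all ensembles with average state `σ`. -/
def convexClosure (μ : Measure Y) (m : Y → H →L[ℂ] H) (σ : H →L[ℂ] H) : EReal :=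
  ⨅ (E : Ensemble H) (_ : E.HasAverage σ), extIntegral E.π fun x => outEntropy μ m (E.ρ x)

end Channel

/-- The operator density `m₁(y₁) ⊗ m₂(y₂)` of the observable `M₁ ⊗ M₂` with respect to the product
measure `μ₁ × μ₂`. -/
def prodDensity {H₁ H₂ Y₁ Y₂ : Type*}
    [NormedAddCommGroup H₁] [InnerProductSpace ℂ H₁] [CompleteSpace H₁]
    [NormedAddCommGroup H₂] [InnerProductSpace ℂ H₂] [CompleteSpace H₂]
    (m₁ : Y₁ → H₁ →L[ℂ] H₁) (m₂ : Y₂ → H₂ →L[ℂ] H₂) (y : Y₁ × Y₂) :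
    HTensor H₁ H₂ →L[ℂ] HTensor H₁ H₂ :=
  opTensor (m₁ y.1) (m₂ y.2)

end MeasChannel

end

/-! Enlarge `b` so that `b ≥ 1`. Every output density of a state satisfies `0 ≤ p ≤ b`, so `p log (b
/ p)` is nonnegative, and since `p` integrates to one, its integral is the output entropy plus `log
b`. Hence the entropy and its convex closure are, up to the finite constant `log b`, the `[0,
∞]`-valued `shiftedEntropy` and `shiftedClosure`. This gives `e_M > -∞`, and Tonelli and Fatou then
apply without integrability conditions. The constants fit tensor products because `log (b₁ b₂) = log
b₁ + log b₂`. States are handled through their quadratic forms in `[0, ∞]`, which determine averages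
by polarization, and traces are Hilbert-Schmidt sums of square roots.

Convexity: the mixture of an ensemble for `ρ` and one for `σ` is an ensemble for the mixture of `ρ`
and `σ`.

Lower semicontinuity: the positive operators of trace at most one are compact and metrizable in the
weak operator topology, so the laws of nearly optimal ensembles for `σ n → ρ` have a weakly
convergent subsequence. The limit law has average `ρ`; as `ρ` has trace one, the law is carried by
the states (`ae_trPos_eq_one`), so no mass is lost. On states `Tr T m` is continuous for bounded
positive `m` (`continuous_trPair_stateSet`), so the portmanteau theorem for each outcome and Fatou
over the outcomes bound the limiting mean entropy (`lintegral_shiftedEntropy_le_liminf`).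

Superadditivity rests on the chain rule `shiftedEntropy_prod`: measuring `M₁` first, the joint
entropy is the entropy of the first outcome in `Tr₂ T` plus the mean entropy of `M₂` in the
posterior states on the second factor. For an ensemble with average `ρ₁₂`, the partial traces over
the second factor average to `ρ₁`, and the posterior states, weighted by the outcome density,
average to `ρ₂`. The two terms are thus bounded below by the two convex closures.

Additivity: superadditivity gives one inequality. Products of ensembles give the other, since on a
product state the posterior is the second factor and the entropies add. -/

noncomputable section

namespace MeasChannel

/-! ### Traces of positive operators with values in `[0, ∞]` -/

section PositiveTrace

set_option linter.unusedSectionVars false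

open ContinuousLinearMap

variable {H K : Type*} [NormedAddCommGroup H] [InnerProductSpace ℂ H] [CompleteSpace H]
  [NormedAddCommGroup K] [InnerProductSpace ℂ K] [CompleteSpace K]

/-- The quadratic form `⟨φ, T φ⟩` of an operator, as an extended nonnegative real. -/
def qform (T : H →L[ℂ] H) (φ : H) : ℝ≥0∞ := ENNReal.ofReal (⟪φ, T φ⟫_ℂ).re

theorem qform_adjoint_conj (A : K →L[ℂ] H) (T : H →L[ℂ] H) (φ : K) :
    qform (adjoint A ∘L T ∘L A) φ = qform T (A φ) := by
  simp [qform, adjoint_inner_right]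

theorem qform_conj_adjoint (A : K →L[ℂ] H) (T : K →L[ℂ] K) (φ : H) :
    qform (A ∘L T ∘L adjoint A) φ = qform T (adjoint A φ) := by
  simp [qform, adjoint_inner_left]

theorem qform_adjoint_comp_self (S : H →L[ℂ] K) (φ : H) :
    qform (adjoint S ∘L S) φ = ‖S φ‖ₑ ^ 2 := by
  have h : (⟪φ, (adjoint S ∘L S) φ⟫_ℂ).re = ‖S φ‖ ^ 2 := by
    rw [comp_apply, adjoint_inner_right, inner_self_eq_norm_sq_to_K]
    norm_cast
  rw [qform, h, ENNReal.ofReal_pow (norm_nonneg _), ofReal_norm]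

theorem qform_comp_adjoint_self (S : K →L[ℂ] H) (φ : H) :
    qform (S ∘L adjoint S) φ = ‖adjoint S φ‖ₑ ^ 2 := by
  simpa using qform_adjoint_comp_self (adjoint S) φ

theorem re_inner_nonneg {T : H →L[ℂ] H} (hT : T.IsPositive) (φ : H) : 0 ≤ (⟪φ, T φ⟫_ℂ).re :=
  hT.re_inner_nonneg_right φ

theorem ofReal_qform {T : H →L[ℂ] H} (hT : T.IsPositive) (φ : H) :
    (((qform T φ).toReal : ℝ) : ℂ) = ⟪φ, T φ⟫_ℂ := by
  have h := hT.inner_nonneg_right φ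
  rw [qform, ENNReal.toReal_ofReal (re_inner_nonneg hT φ)]
  exact (Complex.eq_re_of_ofReal_le (r := 0) (by simpa using h)).symm

theorem qform_ne_top (T : H →L[ℂ] H) (φ : H) : qform T φ ≠ ∞ := ENNReal.ofReal_ne_top

theorem qform_add {T S : H →L[ℂ] H} (hT : T.IsPositive) (hS : S.IsPositive) (φ : H) :
    qform (T + S) φ = qform T φ + qform S φ := by
  rw [qform, qform, qform, add_apply, inner_add_right, Complex.add_re,
    ENNReal.ofReal_add (re_inner_nonneg hT φ) (re_inner_nonneg hS φ)]

theorem qform_smul {c : ℝ} (hc : 0 ≤ c) (T : H →L[ℂ] H) (φ : H) :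
    qform (c • T) φ = ENNReal.ofReal c * qform T φ := by
  rw [qform, qform, smul_apply, inner_smul_right_eq_smul, Complex.smul_re, smul_eq_mul,
    ENNReal.ofReal_mul hc]

theorem qform_one (φ : H) : qform (1 : H →L[ℂ] H) φ = ‖φ‖ₑ ^ 2 := by
  have h := qform_adjoint_comp_self (1 : H →L[ℂ] H) φ
  have h1 : adjoint (1 : H →L[ℂ] H) ∘L (1 : H →L[ℂ] H) = 1 := by
    ext x
    refine ext_inner_right ℂ fun v => ?_
    simp [adjoint_inner_left]
  rwa [h1] at h

/-- The adjoint of the positive square root. -/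
theorem adjoint_sqrt (T : H →L[ℂ] H) : adjoint (CFC.sqrt T) = CFC.sqrt T :=
  ((nonneg_iff_isPositive _).1 (CFC.sqrt_nonneg T)).isSelfAdjoint.adjoint_eq

theorem sqrt_comp_sqrt {T : H →L[ℂ] H} (hT : T.IsPositive) : CFC.sqrt T ∘L CFC.sqrt T = T :=
  CFC.sqrt_mul_sqrt_self T ((nonneg_iff_isPositive T).2 hT)

theorem sqrt_comp_adjoint_sqrt {T : H →L[ℂ] H} (hT : T.IsPositive) :
    CFC.sqrt T ∘L adjoint (CFC.sqrt T) = T := by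
  rw [adjoint_sqrt, sqrt_comp_sqrt hT]

theorem qform_eq_enorm_sqrt {T : H →L[ℂ] H} (hT : T.IsPositive) (φ : H) :
    qform T φ = ‖CFC.sqrt T φ‖ₑ ^ 2 := by
  rw [← qform_adjoint_comp_self, adjoint_sqrt, sqrt_comp_sqrt hT]

theorem tsum_enorm_inner_sq {ι : Type*} (b : HilbertBasis ι ℂ H) (x : H) :
    ∑' i, ‖⟪b i, x⟫_ℂ‖ₑ ^ 2 = ‖x‖ₑ ^ 2 := by
  have h := b.hasSum_inner_mul_inner x x
  have h2 : HasSum (fun i => ‖⟪b i, x⟫_ℂ‖ ^ 2) (‖x‖ ^ 2) := by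
    have h3 := Complex.hasSum_re h
    rw [inner_self_eq_norm_sq_to_K] at h3
    convert h3 using 1
    · ext i
      rw [← inner_conj_symm x, mul_comm, Complex.mul_conj, Complex.ofReal_re,
        Complex.normSq_eq_norm_sq]
    · norm_cast
  calc ∑' i, ‖⟪b i, x⟫_ℂ‖ₑ ^ 2 = ∑' i, ENNReal.ofReal (‖⟪b i, x⟫_ℂ‖ ^ 2) := by
        congr with i
        rw [ENNReal.ofReal_pow (norm_nonneg _), ofReal_norm]
    _ = ENNReal.ofReal (‖x‖ ^ 2) := by
        rw [← ENNReal.ofReal_tsum_of_nonneg (fun i => by positivity) h2.summable, h2.tsum_eq]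
    _ = ‖x‖ₑ ^ 2 := by rw [ENNReal.ofReal_pow (norm_nonneg _), ofReal_norm]

/-- The Hilbert-Schmidt norms of an operator and of its adjoint agree, in any bases. -/
theorem tsum_enorm_sq_adjoint {ι κ : Type*} (b : HilbertBasis ι ℂ H) (c : HilbertBasis κ ℂ K)
    (A : H →L[ℂ] K) : ∑' i, ‖A (b i)‖ₑ ^ 2 = ∑' j, ‖adjoint A (c j)‖ₑ ^ 2 := by
  simp_rw [← tsum_enorm_inner_sq c (A _), ← tsum_enorm_inner_sq b (adjoint A _)]
  rw [ENNReal.tsum_comm]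
  congr with j
  congr with i
  rw [adjoint_inner_right, ← ofReal_norm, norm_inner_symm, ofReal_norm]

/-- The trace of a positive operator, in `[0, ∞]`. -/
def trPos (T : H →L[ℂ] H) : ℝ≥0∞ := ∑' i, qform T (onb H i)

/-- The trace is the squared Hilbert-Schmidt norm of the self-adjoint `√T`, which is the same in
every basis. -/
theorem trPos_eq {ι : Type*} (b : HilbertBasis ι ℂ H) {T : H →L[ℂ] H} (hT : T.IsPositive) :
    trPos T = ∑' i, qform T (b i) := by
  simp_rw [trPos, qform_eq_enorm_sqrt hT]
  rw [tsum_enorm_sq_adjoint (onb H) b, adjoint_sqrt]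

/-- `Tr T m = ∑ᵢ ⟨√T eᵢ, m √T eᵢ⟩` for positive operators `T` and `m`, in `[0, ∞]`. -/
def trPair (T m : H →L[ℂ] H) : ℝ≥0∞ := ∑' i, qform m (CFC.sqrt T (onb H i))

/-- Both sides are squared Hilbert-Schmidt norms, of `A* √T` and of its adjoint `√T A`. Any
factorization of the second argument may thus be used, not only the square root. -/
theorem trPair_comp_adjoint {ι : Type*} (b : HilbertBasis ι ℂ K) {T : H →L[ℂ] H}
    (hT : T.IsPositive) (A : K →L[ℂ] H) :
    trPair T (A ∘L adjoint A) = ∑' i, qform T (A (b i)) := by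
  simp_rw [trPair, qform_comp_adjoint_self, qform_eq_enorm_sqrt hT]
  have h := tsum_enorm_sq_adjoint (onb H) b (adjoint A ∘L CFC.sqrt T)
  simpa [adjoint_comp, adjoint_sqrt] using h

theorem trPair_eq {ι : Type*} (b : HilbertBasis ι ℂ H) {T m : H →L[ℂ] H}
    (hT : T.IsPositive) (hm : m.IsPositive) :
    trPair T m = ∑' i, qform T (CFC.sqrt m (b i)) := by
  conv_lhs => rw [← sqrt_comp_adjoint_sqrt hm]
  exact trPair_comp_adjoint b hT _

theorem trPair_eq_tsum_sqrt_left {ι : Type*} (b : HilbertBasis ι ℂ H) {T m : H →L[ℂ] H}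
    (hT : T.IsPositive) (hm : m.IsPositive) :
    trPair T m = ∑' i, qform m (CFC.sqrt T (b i)) := by
  rw [trPair_eq (onb H) hT hm, ← trPair_eq b hm hT]
  rfl

theorem trPair_one {T : H →L[ℂ] H} (hT : T.IsPositive) : trPair T 1 = trPos T := by
  simp_rw [trPair, qform_one, trPos, qform_eq_enorm_sqrt hT]

theorem qform_le {m : H →L[ℂ] H} {b : ℝ} (hb : ‖m‖ ≤ b) (φ : H) :
    qform m φ ≤ ENNReal.ofReal b * ‖φ‖ₑ ^ 2 := by
  rw [← ofReal_norm, ← ENNReal.ofReal_pow (norm_nonneg _),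
    ← ENNReal.ofReal_mul ((norm_nonneg m).trans hb)]
  refine ENNReal.ofReal_le_ofReal ?_
  calc (⟪φ, m φ⟫_ℂ).re ≤ ‖φ‖ * ‖m φ‖ := re_inner_le_norm (𝕜 := ℂ) φ (m φ)
    _ ≤ ‖φ‖ * (b * ‖φ‖) := by gcongr; exact m.le_of_opNorm_le hb φ
    _ = b * ‖φ‖ ^ 2 := by ring

theorem trPair_le {T m : H →L[ℂ] H} (hT : T.IsPositive) {b : ℝ} (hb : ‖m‖ ≤ b) :
    trPair T m ≤ ENNReal.ofReal b * trPos T := by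
  rw [trPair, ← trPair_one hT, trPair, ← ENNReal.tsum_mul_left]
  exact ENNReal.tsum_le_tsum fun i => by rw [qform_one]; exact qform_le hb _

theorem isState_iff {T : H →L[ℂ] H} : IsState T ↔ T.IsPositive ∧ trPos T = 1 := by
  constructor
  · rintro ⟨h, hs⟩
    refine ⟨h, ?_⟩
    have h2 := Complex.hasSum_re hs
    simp only [trPos, qform]
    rw [← ENNReal.ofReal_tsum_of_nonneg (fun i => re_inner_nonneg h _) h2.summable,
      h2.tsum_eq]
    simp
  · rintro ⟨h, hs⟩
    refine ⟨h, ?_⟩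
    have h2 := ENNReal.hasSum_toReal (f := fun i => qform T (onb H i)) (by
      change trPos T ≠ ∞; simp [hs])
    have h3 := Complex.hasSum_ofReal.2 h2
    simp_rw [ofReal_qform h] at h3
    convert h3 using 1
    rw [← ENNReal.tsum_toReal_eq fun i => qform_ne_top _ _]
    change (1 : ℂ) = (((trPos T).toReal : ℝ) : ℂ)
    simp [hs]

theorem norm_le_trPos {T : H →L[ℂ] H} (hT : T.IsPositive) : ‖T‖ₑ ≤ trPos T := by
  by_cases htop : trPos T = ∞
  · simp [htop]
  -- Cauchy-Schwarz in each coefficient `⟨eᵢ, √T φ⟩ = ⟨√T eᵢ, φ⟩`: the operator norm of `√T` is at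
  -- most its Hilbert-Schmidt norm.
  have key : ∀ φ, ‖CFC.sqrt T φ‖ₑ ^ 2 ≤ trPos T * ‖φ‖ₑ ^ 2 := by
    intro φ
    rw [← tsum_enorm_inner_sq (onb H), trPos, ← ENNReal.tsum_mul_right]
    refine ENNReal.tsum_le_tsum fun i => ?_
    rw [qform_eq_enorm_sqrt hT, ← mul_pow]
    gcongr
    rw [← adjoint_inner_left, adjoint_sqrt]
    rw [← ofReal_norm, ← ofReal_norm, ← ofReal_norm,
      ← ENNReal.ofReal_mul (norm_nonneg _)]
    exact ENNReal.ofReal_le_ofReal (norm_inner_le_norm _ _)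
  have hS : ‖CFC.sqrt T‖ ≤ Real.sqrt (trPos T).toReal := by
    refine opNorm_le_bound _ (Real.sqrt_nonneg _) fun φ => ?_
    have h := ENNReal.toReal_mono (by finiteness) (key φ)
    simp only [ENNReal.toReal_pow, toReal_enorm, ENNReal.toReal_mul] at h
    rw [← Real.sqrt_sq (norm_nonneg φ), ← Real.sqrt_mul ENNReal.toReal_nonneg]
    exact Real.le_sqrt_of_sq_le h
  have hTn : ‖T‖ = ‖CFC.sqrt T‖ * ‖CFC.sqrt T‖ := by
    rw [← norm_adjoint_comp_self, adjoint_sqrt, sqrt_comp_sqrt hT]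
  have : ‖T‖ ≤ (trPos T).toReal := by
    rw [hTn, ← Real.mul_self_sqrt (ENNReal.toReal_nonneg (a := trPos T))]
    exact mul_le_mul hS hS (norm_nonneg _) (Real.sqrt_nonneg _)
  rw [← ofReal_norm]
  exact (ENNReal.ofReal_le_iff_le_toReal htop).2 this

theorem summable_norm_inner_sq {ι κ : Type*} (b : HilbertBasis ι ℂ H) (c : HilbertBasis κ ℂ K)
    (D : H →L[ℂ] K) (hD : ∑' i, ‖D (b i)‖ₑ ^ 2 ≠ ∞) :
    Summable fun p : ι × κ => ‖⟪c p.2, D (b p.1)⟫_ℂ‖ ^ 2 := by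
  have h : ∑' p : ι × κ, ‖⟪c p.2, D (b p.1)⟫_ℂ‖ₑ ^ 2 ≠ ∞ := by
    rw [ENNReal.tsum_prod (f := fun i j => ‖⟪c j, D (b i)⟫_ℂ‖ₑ ^ 2)]
    simpa only [tsum_enorm_inner_sq c] using hD
  simpa using ENNReal.summable_toReal h

theorem summable_inner_mul_inner {ι κ : Type*} (b : HilbertBasis ι ℂ H) (c : HilbertBasis κ ℂ K)
    (A B : H →L[ℂ] K) (hA : ∑' i, ‖A (b i)‖ₑ ^ 2 ≠ ∞) (hB : ∑' i, ‖B (b i)‖ₑ ^ 2 ≠ ∞) :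
    Summable fun p : ι × κ => ⟪A (b p.1), c p.2⟫_ℂ * ⟪c p.2, B (b p.1)⟫_ℂ := by
  refine Summable.of_norm_bounded
    ((summable_norm_inner_sq b c A hA).add (summable_norm_inner_sq b c B hB)) fun p => ?_
  rw [norm_mul, norm_inner_symm]
  have : ∀ s t : ℝ, s * t ≤ s ^ 2 + t ^ 2 := fun s t => by
    nlinarith [sq_nonneg (s - t), sq_nonneg s, sq_nonneg t]
  exact this _ _

/-- The Hilbert-Schmidt inner product of two operators agrees with that of their adjoints. -/
theorem hasSum_inner_adjoint {ι κ : Type*} (b : HilbertBasis ι ℂ H) (c : HilbertBasis κ ℂ K)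
    (A B : H →L[ℂ] K) (hA : ∑' i, ‖A (b i)‖ₑ ^ 2 ≠ ∞) (hB : ∑' i, ‖B (b i)‖ₑ ^ 2 ≠ ∞) :
    ∃ v : ℂ, HasSum (fun i => ⟪A (b i), B (b i)⟫_ℂ) v ∧
      HasSum (fun j => ⟪adjoint B (c j), adjoint A (c j)⟫_ℂ) v := by
  -- The double series converges absolutely, so summing by rows and by columns gives the same value.
  obtain ⟨v, hv⟩ := summable_inner_mul_inner b c A B hA hB
  have h1 : HasSum (fun i => ⟪A (b i), B (b i)⟫_ℂ) v :=
    hv.prod_fiberwise fun i => c.hasSum_inner_mul_inner (A (b i)) (B (b i))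
  have h2 : HasSum (fun p : κ × ι => ⟪A (b p.2), c p.1⟫_ℂ * ⟪c p.1, B (b p.2)⟫_ℂ) v :=
    (Equiv.prodComm κ ι).hasSum_iff.2 hv
  have h3 : ∀ j, HasSum (fun i => ⟪A (b i), c j⟫_ℂ * ⟪c j, B (b i)⟫_ℂ)
      ⟪adjoint B (c j), adjoint A (c j)⟫_ℂ := by
    intro j
    have h := b.hasSum_inner_mul_inner (adjoint B (c j)) (adjoint A (c j))
    simp only [adjoint_inner_left, adjoint_inner_right] at h ⊢
    simpa only [mul_comm] using h
  exact ⟨v, h1, h2.prod_fiberwise h3⟩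

/-- Links `trPair` with the literal trace series of `T m`: the Hilbert-Schmidt product of `√T` and
`√T m` has terms `⟨eᵢ, T m eᵢ⟩`, and passing to adjoints turns them into `⟨√T eᵢ, m √T eᵢ⟩`. -/
theorem hasSum_trPair {ι : Type*} (b : HilbertBasis ι ℂ H) {T m : H →L[ℂ] H}
    (hT : T.IsPositive) (hm : m.IsPositive) (htr : trPos T ≠ ∞) :
    HasSum (fun i => ⟪b i, T (m (b i))⟫_ℂ) (((trPair T m).toReal : ℝ) : ℂ) := by
  have hfin : trPair T m ≠ ∞ := ((trPair_le hT le_rfl).trans_lt (by finiteness)).ne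
  have hA : ∑' i, ‖CFC.sqrt T (b i)‖ₑ ^ 2 ≠ ∞ := by
    simpa only [← qform_eq_enorm_sqrt hT, ← trPos_eq b hT] using htr
  have hB : ∑' i, ‖(CFC.sqrt T ∘L m) (b i)‖ₑ ^ 2 ≠ ∞ := by
    rw [tsum_enorm_sq_adjoint b b, adjoint_comp, adjoint_sqrt]
    refine ((ENNReal.tsum_le_tsum (g := fun i => ‖adjoint m‖ₑ ^ 2 * ‖CFC.sqrt T (b i)‖ₑ ^ 2)
      fun i => ?_).trans_lt ?_).ne
    · rw [← mul_pow]
      gcongr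
      exact (adjoint m).le_opENorm _
    · rw [ENNReal.tsum_mul_left]
      finiteness
  obtain ⟨v, h1, h2⟩ := hasSum_inner_adjoint b b _ _ hA hB
  have h3 := ENNReal.hasSum_toReal (f := fun i => qform m (CFC.sqrt T (b i)))
    (by rwa [← trPair_eq_tsum_sqrt_left b hT hm])
  rw [← ENNReal.tsum_toReal_eq (fun i => qform_ne_top _ _),
    ← trPair_eq_tsum_sqrt_left b hT hm] at h3
  have h4 := Complex.hasSum_ofReal.2 h3
  simp_rw [ofReal_qform hm] at h4
  have h5 : (fun i => ⟪CFC.sqrt T (b i), m (CFC.sqrt T (b i))⟫_ℂ) =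
      fun j => ⟪adjoint (CFC.sqrt T ∘L m) (b j), adjoint (CFC.sqrt T) (b j)⟫_ℂ := by
    ext j
    rw [adjoint_comp, adjoint_sqrt, comp_apply, adjoint_inner_left]
  rw [h5] at h4
  rw [h4.unique h2]
  convert h1 using 2 with i
  conv_lhs => rw [← sqrt_comp_sqrt hT]
  rw [comp_apply, ← adjoint_inner_left, adjoint_sqrt, comp_apply]

theorem outDensity_eq {Y : Type*} {m : Y → H →L[ℂ] H} {T : H →L[ℂ] H} (hT : T.IsPositive)
    (htr : trPos T ≠ ∞) {y : Y} (hm : (m y).IsPositive) :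
    outDensity m T y = (trPair T (m y)).toReal := by
  have h := (hasSum_trPair (onb H) hT hm htr).tsum_eq
  simp only [outDensity, trace, comp_apply]
  rw [h, Complex.ofReal_re]

/-- `|T|` and `T` have the same operator norm. Trace-norm convergence enters the proof only through
this bound. -/
theorem norm_le_traceNorm (T : H →L[ℂ] H) : ‖T‖ₑ ≤ traceNorm T := by
  have h := norm_le_trPos ((nonneg_iff_isPositive _).1 (CFC.abs_nonneg T))
  have h2 : ‖CFC.abs T‖ₑ = ‖T‖ₑ := by
    rw [← ofReal_norm, CFC.norm_abs, ofReal_norm]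
  rwa [h2] at h

end PositiveTrace

/-! ### Measurable fields of operators -/

section MeasurableFields

open ContinuousLinearMap

set_option linter.unusedSectionVars false

variable {H K : Type*} [NormedAddCommGroup H] [InnerProductSpace ℂ H] [CompleteSpace H]
  [NormedAddCommGroup K] [InnerProductSpace ℂ K] [CompleteSpace K]
  {Z : Type*} [MeasurableSpace Z]

/-- Distinct basis vectors are at distance `√2`, so their balls of radius `1/2` are disjoint, and a
separable space contains only countably many disjoint nonempty open sets. -/
theorem countable_hilbertBasis [TopologicalSpace.SeparableSpace H] {ι : Type*}
    (b : HilbertBasis ι ℂ H) : Countable ι := by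
  refine Pairwise.countable_of_isOpen_disjoint (s := fun i => Metric.ball (b i) (1 / 2))
    (fun i j hij => Metric.ball_disjoint_ball ?_) (fun i => Metric.isOpen_ball)
    (fun i => ⟨b i, by simp⟩)
  have h : ‖b i - b j‖ * ‖b i - b j‖ = 2 := by
    rw [norm_sub_mul_self (𝕜 := ℂ), b.orthonormal.2 hij, b.orthonormal.1, b.orthonormal.1]
    norm_num
  rw [dist_eq_norm]
  nlinarith [norm_nonneg (b i - b j)]

instance [TopologicalSpace.SeparableSpace H] : Countable (basisSet H) :=
  countable_hilbertBasis (onb H)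

theorem measurable_of_hasSum {ι : Type*} [Countable ι] {f : ι → Z → ℂ} {g : Z → ℂ}
    (hf : ∀ i, Measurable (f i)) (h : ∀ z, HasSum (fun i => f i z) (g z)) : Measurable g := by
  refine measurable_of_tendsto_metrizable' (Filter.atTop : Filter (Finset ι))
    (f := fun s z => ∑ i ∈ s, f i z) (fun s => Finset.measurable_fun_sum s fun i _ => hf i) ?_
  exact tendsto_pi_nhds.2 fun z => h z

/-- A measurable field of operators: all its matrix elements are measurable. -/
def MeasurableField (T : Z → H →L[ℂ] H) : Prop := ∀ φ ψ : H, Measurable fun z => ⟪φ, T z ψ⟫_ℂ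

theorem measurableField_of_basis {ι : Type*} [Countable ι] (b : HilbertBasis ι ℂ H)
    {T : Z → H →L[ℂ] H} (h : ∀ i j, Measurable fun z => ⟪b i, T z (b j)⟫_ℂ) :
    MeasurableField T := by
  have h1 : ∀ i ψ, Measurable fun z => ⟪b i, T z ψ⟫_ℂ := by
    intro i ψ
    refine measurable_of_hasSum (f := fun j z => ⟪b i, T z (b j)⟫_ℂ * ⟪b j, ψ⟫_ℂ)
      (fun j => (h i j).mul_const _) fun z => ?_
    simpa only [adjoint_inner_left] using b.hasSum_inner_mul_inner (adjoint (T z) (b i)) ψ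
  intro φ ψ
  exact measurable_of_hasSum (f := fun j z => ⟪φ, b j⟫_ℂ * ⟪b j, T z ψ⟫_ℂ)
      (fun j => (h1 j ψ).const_mul _) fun z => b.hasSum_inner_mul_inner _ _

theorem MeasurableField.measurable_inner_comp [TopologicalSpace.SeparableSpace H]
    {T m : Z → H →L[ℂ] H} (hT : MeasurableField T) (hm : MeasurableField m) (φ ψ : H) :
    Measurable fun z => ⟪φ, T z (m z ψ)⟫_ℂ := by
  refine measurable_of_hasSum (f := fun j z => ⟪φ, T z (onb H j)⟫_ℂ * ⟪onb H j, m z ψ⟫_ℂ)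
    (fun j => (hT _ _).mul (hm _ _)) fun z => ?_
  simpa only [adjoint_inner_left] using
    (onb H).hasSum_inner_mul_inner (adjoint (T z) φ) (m z ψ)

theorem MeasurableField.comp {W : Type*} [MeasurableSpace W] {T : Z → H →L[ℂ] H}
    (hT : MeasurableField T) {f : W → Z} (hf : Measurable f) :
    MeasurableField fun w => T (f w) := fun φ ψ => (hT φ ψ).comp hf

theorem MeasurableField.measurable_qform {T : Z → H →L[ℂ] H} (hT : MeasurableField T) (φ : H) :
    Measurable fun z => qform (T z) φ :=
  (Complex.measurable_re.comp (hT φ φ)).ennreal_ofReal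

theorem MeasurableField.conj_adjoint {T : Z → K →L[ℂ] K} (hT : MeasurableField T)
    (A : K →L[ℂ] H) : MeasurableField fun z => A ∘L T z ∘L adjoint A := by
  intro φ ψ
  simpa only [comp_apply, ← adjoint_inner_left A] using hT (adjoint A φ) (adjoint A ψ)

/-- Measurability of a field of positive operators may be tested on its quadratic forms. -/
theorem measurableField_of_qform {T : Z → H →L[ℂ] H} (hpos : ∀ z, (T z).IsPositive)
    (h : ∀ φ, Measurable fun z => qform (T z) φ) : MeasurableField T := by
  have h1 : ∀ φ, Measurable fun z => ⟪T z φ, φ⟫_ℂ := by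
    intro φ
    have : (fun z => ⟪T z φ, φ⟫_ℂ) = fun z => (((qform (T z) φ).toReal : ℝ) : ℂ) := by
      ext z
      rw [ofReal_qform (hpos z), (hpos z).inner_left_eq_inner_right]
    rw [this]
    exact Complex.measurable_ofReal.comp (h φ).ennreal_toReal
  intro φ ψ
  have h2 : (fun z => ⟪φ, T z ψ⟫_ℂ) = fun z => (⟪T z (ψ + φ), ψ + φ⟫_ℂ - ⟪T z (ψ - φ), ψ - φ⟫_ℂ +
      Complex.I * ⟪T z (ψ + Complex.I • φ), ψ + Complex.I • φ⟫_ℂ -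
      Complex.I * ⟪T z (ψ - Complex.I • φ), ψ - Complex.I • φ⟫_ℂ) / 4 := by
    ext z
    rw [← (hpos z).inner_left_eq_inner_right]
    exact inner_map_polarization (T z).toLinearMap ψ φ
  rw [h2]
  exact (((((h1 _).sub (h1 _)).add ((h1 _).const_mul _)).sub ((h1 _).const_mul _)).div_const _)

theorem measurable_trPos [TopologicalSpace.SeparableSpace H] {T : Z → H →L[ℂ] H}
    (hT : MeasurableField T) : Measurable fun z => trPos (T z) :=
  Measurable.tsum fun _ => hT.measurable_qform _

/-- The series defining `trPair` involves `√T`, whose measurability in the parameter is not evident.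
The trace series of `T m` has the same sum and visibly measurable terms. -/
theorem measurable_trPair [TopologicalSpace.SeparableSpace H] {T m : Z → H →L[ℂ] H}
    (hT : MeasurableField T) (hm : MeasurableField m) (hTpos : ∀ z, (T z).IsPositive)
    (hmpos : ∀ z, (m z).IsPositive) (htr : ∀ z, trPos (T z) ≠ ∞) :
    Measurable fun z => trPair (T z) (m z) := by
  have h1 : Measurable fun z => (((trPair (T z) (m z)).toReal : ℝ) : ℂ) :=
    measurable_of_hasSum (fun i => hT.measurable_inner_comp hm (onb H i) (onb H i))
      fun z => hasSum_trPair (onb H) (hTpos z) (hmpos z) (htr z)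
  have h2 : (fun z => trPair (T z) (m z)) = fun z =>
      ENNReal.ofReal (((trPair (T z) (m z)).toReal : ℝ) : ℂ).re := by
    ext z
    rw [Complex.ofReal_re, ENNReal.ofReal_toReal]
    have := htr z
    exact ((trPair_le (hTpos z) le_rfl).trans_lt (by finiteness)).ne
  rw [h2]
  exact (Complex.measurable_re.comp h1).ennreal_ofReal

end MeasurableFields

/-! ### Integrals of extended-real functions -/

section ExtIntegral

variable {X : Type*} [MeasurableSpace X]

theorem extIntegral_sub {μ : Measure X} {u v : X → ℝ≥0∞} (hu : Measurable u) (hv : Measurable v)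
    (hvt : ∀ x, v x ≠ ∞) (hvi : ∫⁻ x, v x ∂μ ≠ ∞) :
    extIntegral μ (fun x => (u x : EReal) - (v x : EReal)) =
      ((∫⁻ x, u x ∂μ : ℝ≥0∞) : EReal) - ((∫⁻ x, v x ∂μ : ℝ≥0∞) : EReal) := by
  have hp : ∀ x, ((u x : EReal) - (v x : EReal)).toENNReal = u x - v x := fun x => by
    rw [EReal.toENNReal_sub (EReal.coe_ennreal_nonneg _), EReal.toENNReal_coe,
      EReal.toENNReal_coe]
  have hn : ∀ x, (-((u x : EReal) - (v x : EReal))).toENNReal = v x - u x := fun x => by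
    rw [EReal.neg_sub (Or.inr (by simp)) (Or.inr (by simpa using hvt x)), add_comm,
      ← sub_eq_add_neg, EReal.toENNReal_sub (EReal.coe_ennreal_nonneg _), EReal.toENNReal_coe,
      EReal.toENNReal_coe]
  unfold extIntegral
  simp_rw [hp, hn]
  -- With truncated subtraction both integrands equal `max u v`; this avoids subtracting integrals
  -- that may be infinite.
  have h1 : (∫⁻ x, (u x - v x) ∂μ) + ∫⁻ x, v x ∂μ = ∫⁻ x, u x ∂μ + ∫⁻ x, (v x - u x) ∂μ := by
    rw [← lintegral_add_right _ hv, ← lintegral_add_left hu]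
    exact lintegral_congr fun x => by rw [tsub_add_eq_max, add_tsub_eq_max]
  have h2 : ∫⁻ x, (v x - u x) ∂μ ≠ ∞ :=
    ((lintegral_mono fun x => tsub_le_self).trans_lt hvi.lt_top).ne
  generalize (∫⁻ x, (u x - v x) ∂μ) = A at *
  generalize (∫⁻ x, (v x - u x) ∂μ) = B at *
  generalize (∫⁻ x, u x ∂μ) = U at *
  generalize (∫⁻ x, v x ∂μ) = V at *
  lift B to NNReal using h2
  lift V to NNReal using hvi
  by_cases hU : U = ∞
  · subst hU
    have hA : A = ∞ := by simpa using h1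
    subst hA
    simp
  · lift U to NNReal using hU
    have hA : A ≠ ∞ := fun h => by simp [h, ← ENNReal.coe_add] at h1
    lift A to NNReal using hA
    have h3 : (A : ℝ) + V = U + B := by exact_mod_cast h1
    simp only [EReal.coe_nnreal_eq_coe_real, ← EReal.coe_sub, EReal.coe_eq_coe_iff]
    linarith

theorem extIntegral_sub_const {π : Measure X} [IsProbabilityMeasure π] {u : X → ℝ≥0∞}
    (hu : Measurable u) {c : ℝ} (hc : 0 ≤ c) :
    extIntegral π (fun x => (u x : EReal) - (c : EReal)) =
      ((∫⁻ x, u x ∂π : ℝ≥0∞) : EReal) - (c : EReal) := by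
  have h := extIntegral_sub (μ := π) (v := fun _ => ENNReal.ofReal c) hu measurable_const
    (by simp) (by simp)
  simpa [hc] using h

end ExtIntegral

/-! ### Nonnegative form of the differential entropy -/

/-- `s log (b / s)`, which is nonnegative for `0 ≤ s ≤ b`. -/
def entFun (b s : ℝ) : ℝ := s * Real.log b + Real.negMulLog s

theorem continuous_entFun (b : ℝ) : Continuous (entFun b) := by
  unfold entFun
  exact (continuous_id.mul continuous_const).add Real.continuous_negMulLog

theorem entFun_nonneg {b s : ℝ} (hs : 0 ≤ s) (hsb : s ≤ b) : 0 ≤ entFun b s := by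
  rcases hs.eq_or_lt with rfl | hs
  · simp [entFun]
  · have := Real.log_le_log hs hsb
    simp only [entFun, Real.negMulLog]
    nlinarith

/-- Pointwise source of the chain rule. Taking the product of the bounds makes the `log` terms split
with no remainder. -/
theorem entFun_mul {b₁ b₂ s t : ℝ} (hb₁ : 0 < b₁) (hb₂ : 0 < b₂) :
    entFun (b₁ * b₂) (s * t) = t * entFun b₁ s + s * entFun b₂ t := by
  simp only [entFun, Real.negMulLog_mul, Real.log_mul hb₁.ne' hb₂.ne']
  ring

/-- Write `-p log p` as `p log (b / p) - p log b`; the subtracted term has the finite integral `log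
b`. -/
theorem extIntegral_negMulLog {Y : Type*} [MeasurableSpace Y] {μ : Measure Y} {p : Y → ℝ} {b : ℝ}
    (hb : 1 ≤ b) (hp : Measurable p) (h0 : ∀ y, 0 ≤ p y) (hpb : ∀ y, p y ≤ b)
    (h1 : ∫⁻ y, ENNReal.ofReal (p y) ∂μ = 1) :
    extIntegral μ (fun y => (Real.negMulLog (p y) : EReal)) =
      ((∫⁻ y, ENNReal.ofReal (entFun b (p y)) ∂μ : ℝ≥0∞) : EReal) - (Real.log b : EReal) := by
  have hl : 0 ≤ Real.log b := Real.log_nonneg hb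
  have hv : ∫⁻ y, ENNReal.ofReal (p y * Real.log b) ∂μ = ENNReal.ofReal (Real.log b) := by
    simp_rw [ENNReal.ofReal_mul (h0 _)]
    rw [lintegral_mul_const _ hp.ennreal_ofReal, h1, one_mul]
  have h := extIntegral_sub (μ := μ) (u := fun y => ENNReal.ofReal (entFun b (p y)))
    (v := fun y => ENNReal.ofReal (p y * Real.log b))
    ((continuous_entFun b).measurable.comp hp).ennreal_ofReal
    (hp.mul_const _).ennreal_ofReal (by simp) (by simp [hv])
  rw [hv] at h
  have h2 : (fun y => (Real.negMulLog (p y) : EReal)) = fun y =>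
      ((ENNReal.ofReal (entFun b (p y)) : ℝ≥0∞) : EReal) -
        ((ENNReal.ofReal (p y * Real.log b) : ℝ≥0∞) : EReal) := by
    ext y
    rw [EReal.coe_ennreal_ofReal, EReal.coe_ennreal_ofReal,
      max_eq_left (entFun_nonneg (h0 y) (hpb y)), max_eq_left (mul_nonneg (h0 y) hl),
      ← EReal.coe_sub, entFun, add_sub_cancel_left]
  rw [h2, h, EReal.coe_ennreal_ofReal, max_eq_left hl]

/-! ### Shifted entropy and shifted convex closure -/

section Entropy

open ContinuousLinearMap

set_option linter.unusedSectionVars false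

variable {H K : Type*} [NormedAddCommGroup H] [InnerProductSpace ℂ H] [CompleteSpace H]
  [NormedAddCommGroup K] [InnerProductSpace ℂ K] [CompleteSpace K]
  {Y : Type*} [MeasurableSpace Y]

/-- The output differential entropy shifted by `log b`, in `[0, ∞]`. -/
def shiftedEntropy (μ : Measure Y) (m : Y → H →L[ℂ] H) (b : ℝ) (T : H →L[ℂ] H) : ℝ≥0∞ :=
  ∫⁻ y, ENNReal.ofReal (entFun b (trPair T (m y)).toReal) ∂μ

/-- The convex closure shifted by `log b`, in `[0, ∞]`. -/
def shiftedClosure (μ : Measure Y) (m : Y → H →L[ℂ] H) (b : ℝ) (σ : H →L[ℂ] H) : ℝ≥0∞ :=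
  ⨅ E : {E : Ensemble H // E.HasAverage σ}, ∫⁻ x, shiftedEntropy μ m b (E.1.ρ x) ∂E.1.π

theorem IsPOVMDensity.mono {μ : Measure Y} {m : Y → H →L[ℂ] H} {b b' : ℝ}
    (hm : IsPOVMDensity μ m b) (h : b ≤ b') : IsPOVMDensity μ m b' :=
  ⟨hm.measurable, hm.isPositive, fun y => (hm.norm_le y).trans h, hm.lintegral_eq⟩

theorem IsPOVMDensity.lintegral_qform {μ : Measure Y} {m : Y → H →L[ℂ] H} {b : ℝ}
    (hm : IsPOVMDensity μ m b) (φ : H) : ∫⁻ y, qform (m y) φ ∂μ = ‖φ‖ₑ ^ 2 := by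
  have := hm.lintegral_eq φ
  rwa [ENNReal.ofReal_pow (norm_nonneg _), ofReal_norm] at this

/-- Normalization of the POVM, applied term by term to the vectors `A* √T eᵢ`. Besides `A = 1`, it
is used with `A = tensorRight φ` to average posterior operators over the outcomes. -/
theorem IsPOVMDensity.lintegral_trPair_conj [TopologicalSpace.SeparableSpace H] {μ : Measure Y}
    {m : Y → K →L[ℂ] K} {b : ℝ} (hm : IsPOVMDensity μ m b) (T : H →L[ℂ] H)
    (A : K →L[ℂ] H) :
    ∫⁻ y, trPair T (A ∘L m y ∘L adjoint A) ∂μ = trPair T (A ∘L adjoint A) := by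
  simp_rw [trPair]
  rw [lintegral_tsum fun i => ((MeasurableField.conj_adjoint hm.measurable A).measurable_qform
    _).aemeasurable]
  congr with i
  simp_rw [qform_conj_adjoint, hm.lintegral_qform, qform_comp_adjoint_self]

theorem IsPOVMDensity.lintegral_trPair [TopologicalSpace.SeparableSpace H] {μ : Measure Y}
    {m : Y → H →L[ℂ] H} {b : ℝ} (hm : IsPOVMDensity μ m b) {T : H →L[ℂ] H}
    (hT : T.IsPositive) : ∫⁻ y, trPair T (m y) ∂μ = trPos T := by
  have h := hm.lintegral_trPair_conj T (1 : H →L[ℂ] H)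
  have h1 : adjoint (1 : H →L[ℂ] H) = 1 := (IsSelfAdjoint.one (H →L[ℂ] H)).adjoint_eq
  rw [h1] at h
  rw [← trPair_one hT]
  exact h

theorem IsPOVMDensity.trPair_toReal_le {μ : Measure Y} {m : Y → H →L[ℂ] H} {b : ℝ}
    (hm : IsPOVMDensity μ m b) {T : H →L[ℂ] H} (hT : IsState T) (y : Y) :
    (trPair T (m y)).toReal ≤ b := by
  rw [isState_iff] at hT
  have h := trPair_le hT.1 (hm.norm_le y)
  rw [hT.2, mul_one] at h
  exact ENNReal.toReal_le_of_le_ofReal ((norm_nonneg _).trans (hm.norm_le y)) h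

theorem trPair_ne_top {T m : H →L[ℂ] H} (hT : T.IsPositive) (htr : trPos T ≠ ∞) :
    trPair T m ≠ ∞ := ((trPair_le hT le_rfl).trans_lt (by finiteness)).ne

theorem IsState.trPos_ne_top {T : H →L[ℂ] H} (hT : IsState T) : trPos T ≠ ∞ := by
  simp [(isState_iff.1 hT).2]

theorem IsPOVMDensity.outEntropy_eq [TopologicalSpace.SeparableSpace H] {μ : Measure Y}
    {m : Y → H →L[ℂ] H} {b : ℝ} (hb : 1 ≤ b) (hm : IsPOVMDensity μ m b) {T : H →L[ℂ] H}
    (hT : IsState T) :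
    outEntropy μ m T = (shiftedEntropy μ m b T : EReal) - (Real.log b : EReal) := by
  have hT' := isState_iff.1 hT
  have hmeas : Measurable fun y => trPair T (m y) :=
    measurable_trPair (T := fun _ => T) (fun φ ψ => measurable_const) hm.measurable
      (fun _ => hT.isPositive) hm.isPositive fun _ => hT.trPos_ne_top
  have h1 : ∫⁻ y, ENNReal.ofReal (trPair T (m y)).toReal ∂μ = 1 := by
    simp_rw [ENNReal.ofReal_toReal (trPair_ne_top hT.isPositive hT.trPos_ne_top)]
    rw [hm.lintegral_trPair hT.isPositive, hT'.2]
  unfold outEntropy shiftedEntropy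
  simp_rw [outDensity_eq hT.isPositive hT.trPos_ne_top (hm.isPositive _)]
  exact extIntegral_negMulLog hb hmeas.ennreal_toReal (fun _ => ENNReal.toReal_nonneg)
    (fun y => hm.trPair_toReal_le hT y) h1

theorem IsPOVMDensity.measurable_entFun_trPair [TopologicalSpace.SeparableSpace H] {μ : Measure Y}
    {m : Y → H →L[ℂ] H} {b : ℝ} (hm : IsPOVMDensity μ m b)
    {X : Type*} [MeasurableSpace X] {ρ : X → H →L[ℂ] H} (hρ : MeasurableField ρ)
    (hpos : ∀ x, (ρ x).IsPositive) (htr : ∀ x, trPos (ρ x) ≠ ∞) :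
    Measurable fun z : X × Y => ENNReal.ofReal (entFun b (trPair (ρ z.1) (m z.2)).toReal) :=
  ((continuous_entFun b).measurable.comp (measurable_trPair (hρ.comp measurable_fst)
    (MeasurableField.comp hm.measurable measurable_snd) (fun z => hpos z.1)
    (fun z => hm.isPositive z.2) fun z => htr z.1).ennreal_toReal).ennreal_ofReal

theorem IsPOVMDensity.measurable_shiftedEntropy [TopologicalSpace.SeparableSpace H]
    {μ : Measure Y} [SFinite μ] {m : Y → H →L[ℂ] H} {b : ℝ} (hm : IsPOVMDensity μ m b)
    {X : Type*} [MeasurableSpace X] {ρ : X → H →L[ℂ] H} (hρ : MeasurableField ρ)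
    (hpos : ∀ x, (ρ x).IsPositive) (htr : ∀ x, trPos (ρ x) ≠ ∞) :
    Measurable fun x => shiftedEntropy μ m b (ρ x) :=
  (hm.measurable_entFun_trPair hρ hpos htr).lintegral_prod_right'

theorem IsPOVMDensity.convexClosure_eq [TopologicalSpace.SeparableSpace H] {μ : Measure Y}
    [SFinite μ] {m : Y → H →L[ℂ] H} {b : ℝ} (hb : 1 ≤ b) (hm : IsPOVMDensity μ m b)
    (σ : H →L[ℂ] H) :
    convexClosure μ m σ = (shiftedClosure μ m b σ : EReal) - (Real.log b : EReal) := by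
  have hcont : Continuous fun z : ℝ≥0∞ => (z : EReal) - (Real.log b : EReal) := by
    simp_rw [sub_eq_add_neg, ← EReal.coe_neg]
    refine continuous_iff_continuousAt.2 fun z => ?_
    exact (EReal.continuousAt_add (p := ((z : EReal), ((-Real.log b : ℝ) : EReal)))
      (Or.inr (by simp)) (Or.inr (by simp))).comp
      (f := fun z : ℝ≥0∞ => ((z : EReal), ((-Real.log b : ℝ) : EReal)))
      (continuous_coe_ennreal_ereal.prodMk continuous_const).continuousAt
  have hmono : Monotone fun z : ℝ≥0∞ => (z : EReal) - (Real.log b : EReal) :=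
    fun z w h => EReal.sub_le_sub (EReal.coe_ennreal_le_coe_ennreal_iff.2 h) le_rfl
  -- The shift is monotone and continuous and sends `∞` to `⊤`, so it commutes with the infimum even
  -- over an empty family of ensembles.
  rw [shiftedClosure, hmono.map_iInf_of_continuousAt hcont.continuousAt (by simp),
    convexClosure, iInf_subtype']
  refine iInf_congr fun E => ?_
  have h : ∀ x, outEntropy μ m (E.1.ρ x) =
      (shiftedEntropy μ m b (E.1.ρ x) : EReal) - (Real.log b : EReal) :=
    fun x => hm.outEntropy_eq hb (E.1.isState x)
  simp_rw [h]
  exact extIntegral_sub_const (hm.measurable_shiftedEntropy E.1.measurable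
    (fun x => (E.1.isState x).isPositive) fun x => (E.1.isState x).trPos_ne_top)
    (Real.log_nonneg hb)

end Entropy

/-! ### Ensembles and averages -/

section Averages

open ContinuousLinearMap

set_option linter.unusedSectionVars false

variable {H : Type*} [NormedAddCommGroup H] [InnerProductSpace ℂ H] [CompleteSpace H]
  {X : Type*} [MeasurableSpace X] {Y : Type*} [MeasurableSpace Y]

theorem IsState.norm_le_one {T : H →L[ℂ] H} (hT : IsState T) : ‖T‖ ≤ 1 := by
  have h := norm_le_trPos hT.isPositive
  rw [(isState_iff.1 hT).2, ← ofReal_norm, ENNReal.ofReal_le_one] at h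
  exact h

theorem IsState.norm_inner_le {T : H →L[ℂ] H} (hT : IsState T) (φ ψ : H) :
    ‖⟪φ, T ψ⟫_ℂ‖ ≤ ‖φ‖ * ‖ψ‖ :=
  (norm_inner_le_norm _ _).trans (mul_le_mul_of_nonneg_left
    ((T.le_of_opNorm_le hT.norm_le_one ψ).trans_eq (one_mul _)) (norm_nonneg _))

theorem integrable_inner {π : Measure X} [IsFiniteMeasure π] {ρ : X → H →L[ℂ] H}
    (hst : ∀ x, IsState (ρ x)) (hmeas : MeasurableField ρ) (φ ψ : H) :
    Integrable (fun x => ⟪φ, ρ x ψ⟫_ℂ) π :=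
  Integrable.of_bound (hmeas φ ψ).aestronglyMeasurable (‖φ‖ * ‖ψ‖)
    (.of_forall fun x => (hst x).norm_inner_le φ ψ)

theorem lintegral_qform_of_average {π : Measure X} [IsFiniteMeasure π] {ρ : X → H →L[ℂ] H}
    (hst : ∀ x, IsState (ρ x)) (hmeas : MeasurableField ρ) {σ : H →L[ℂ] H}
    (h : ∀ φ ψ : H, ⟪φ, σ ψ⟫_ℂ = ∫ x, ⟪φ, ρ x ψ⟫_ℂ ∂π) (φ : H) :
    ∫⁻ x, qform (ρ x) φ ∂π = qform σ φ := by
  have hi := integrable_inner (π := π) hst hmeas φ φ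
  have h1 : (⟪φ, σ φ⟫_ℂ).re = ∫ x, (⟪φ, ρ x φ⟫_ℂ).re ∂π := by
    rw [h]
    exact (integral_re hi).symm
  simp only [qform]
  rw [h1]
  exact (ofReal_integral_eq_lintegral_ofReal hi.re
    (.of_forall fun x => re_inner_nonneg (hst x).isPositive φ)).symm

/-- Polarization recovers all matrix elements from quadratic forms, so barycenters can be checked
with nonnegative integrals only. -/
theorem average_of_lintegral_qform {π : Measure X} [IsFiniteMeasure π] {ρ : X → H →L[ℂ] H}
    (hst : ∀ x, IsState (ρ x)) (hmeas : MeasurableField ρ) {σ : H →L[ℂ] H} (hσ : σ.IsPositive)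
    (h : ∀ φ, ∫⁻ x, qform (ρ x) φ ∂π = qform σ φ) (φ ψ : H) :
    ⟪φ, σ ψ⟫_ℂ = ∫ x, ⟪φ, ρ x ψ⟫_ℂ ∂π := by
  have hq : ∀ φ, ⟪σ φ, φ⟫_ℂ = ∫ x, ⟪ρ x φ, φ⟫_ℂ ∂π := by
    intro φ
    rw [hσ.inner_left_eq_inner_right, ← ofReal_qform hσ, ← h]
    simp_rw [fun x => (hst x).isPositive.inner_left_eq_inner_right φ φ,
      ← fun x => ofReal_qform (hst x).isPositive φ]
    rw [integral_complex_ofReal, integral_toReal (hmeas.measurable_qform φ).aemeasurable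
      (.of_forall fun x => (qform_ne_top _ _).lt_top)]
  have hi : ∀ φ, Integrable (fun x => ⟪ρ x φ, φ⟫_ℂ) π := fun φ => by
    simpa only [fun x => (hst x).isPositive.inner_left_eq_inner_right φ φ] using
      integrable_inner (π := π) hst hmeas φ φ
  have hpol : ∀ T : H →L[ℂ] H, T.IsPositive → ⟪φ, T ψ⟫_ℂ =
      (⟪T (ψ + φ), ψ + φ⟫_ℂ - ⟪T (ψ - φ), ψ - φ⟫_ℂ +
      Complex.I * ⟪T (ψ + Complex.I • φ), ψ + Complex.I • φ⟫_ℂ -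
      Complex.I * ⟪T (ψ - Complex.I • φ), ψ - Complex.I • φ⟫_ℂ) / 4 := fun T hT => by
    rw [← hT.inner_left_eq_inner_right]
    exact inner_map_polarization T.toLinearMap ψ φ
  simp_rw [fun x => hpol (ρ x) (hst x).isPositive]
  have hintegral : ∀ f₁ f₂ f₃ f₄ : X → ℂ, Integrable f₁ π → Integrable f₂ π → Integrable f₃ π →
      Integrable f₄ π → ∫ x, (f₁ x - f₂ x + Complex.I * f₃ x - Complex.I * f₄ x) ∂π =
        ∫ x, f₁ x ∂π - ∫ x, f₂ x ∂π + Complex.I * ∫ x, f₃ x ∂π - Complex.I * ∫ x, f₄ x ∂π := by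
    intro f₁ f₂ f₃ f₄ i₁ i₂ i₃ i₄
    rw [integral_sub (by fun_prop) (by fun_prop), integral_add (by fun_prop) (by fun_prop),
      integral_sub i₁ i₂, integral_const_mul, integral_const_mul]
  rw [hpol σ hσ, hq, hq, hq, hq, integral_div, hintegral _ _ _ _ (hi _) (hi _) (hi _) (hi _)]

/-- The average of a measurable family of states that is given up to a null set bounds the convex
closure, in any universe. -/
theorem shiftedClosure_le_lintegral [StandardBorelSpace X] {π : Measure X} [IsProbabilityMeasure π]
    {ρ : X → H →L[ℂ] H} (hpos : ∀ x, (ρ x).IsPositive)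
    (hmeas : ∀ φ, Measurable fun x => qform (ρ x) φ) (hst : ∀ᵐ x ∂π, trPos (ρ x) = 1)
    {σ : H →L[ℂ] H} (hσ : σ.IsPositive) (havg : ∀ φ, ∫⁻ x, qform (ρ x) φ ∂π = qform σ φ)
    (μ : Measure Y) (m : Y → H →L[ℂ] H) (b : ℝ) :
    shiftedClosure μ m b σ ≤ ∫⁻ x, shiftedEntropy μ m b (ρ x) ∂π := by
  classical
  -- An ensemble must consist of states everywhere: on a measurable null set `N` containing the bad
  -- points, the fixed state `ρ x₀` is substituted.
  obtain ⟨x₀, hx₀⟩ := hst.exists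
  obtain ⟨N, hN, hNm, hN0⟩ := exists_measurable_superset_of_null (ae_iff.1 hst)
  let ρ' : X → H →L[ℂ] H := fun x => if x ∈ N then ρ x₀ else ρ x
  have hst' : ∀ x, IsState (ρ' x) := by
    intro x
    by_cases hx : x ∈ N
    · simpa [ρ', hx] using isState_iff.2 ⟨hpos x₀, hx₀⟩
    · have : trPos (ρ x) = 1 := by
        by_contra h
        exact hx (hN h)
      simpa [ρ', hx] using isState_iff.2 ⟨hpos x, this⟩
  have hmeas' : MeasurableField ρ' := by
    intro φ ψ
    have h1 : (fun x => ⟪φ, ρ' x ψ⟫_ℂ) = fun x =>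
        if x ∈ N then ⟪φ, ρ x₀ ψ⟫_ℂ else ⟪φ, ρ x ψ⟫_ℂ := by
      ext x
      by_cases hx : x ∈ N <;> simp [ρ', hx]
    rw [h1]
    exact Measurable.ite hNm measurable_const (measurableField_of_qform hpos hmeas φ ψ)
  have hae : ∀ᵐ x ∂π, ρ' x = ρ x := by
    have : ∀ᵐ x ∂π, x ∉ N := measure_eq_zero_iff_ae_notMem.1 hN0
    filter_upwards [this] with x hx
    simp [ρ', hx]
  -- A Borel isomorphism with a subset of `ℝ` moves the index space to the lowest universe.
  obtain ⟨s, hs, ⟨e⟩⟩ := exists_subset_real_measurableEquiv X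
  let E : Ensemble H :=
    { X := s
      measurableSpace := inferInstance
      standardBorel := hs.standardBorel
      π := π.map e
      isProbabilityMeasure := Measure.isProbabilityMeasure_map e.measurable.aemeasurable
      ρ := fun r => ρ' (e.symm r)
      isState := fun r => hst' _
      measurable := fun φ ψ => (hmeas' φ ψ).comp e.symm.measurable }
  have hE : E.HasAverage σ := by
    refine average_of_lintegral_qform E.isState E.measurable hσ fun φ => ?_
    change ∫⁻ r, qform (ρ' (e.symm r)) φ ∂(π.map e) = _
    rw [lintegral_map_equiv, ← havg]
    refine lintegral_congr_ae ?_
    filter_upwards [hae] with x hx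
    simp [hx]
  calc shiftedClosure μ m b σ ≤ ∫⁻ r, shiftedEntropy μ m b (E.ρ r) ∂E.π :=
        iInf_le _ (⟨E, hE⟩ : {E : Ensemble H // E.HasAverage σ})
    _ = ∫⁻ r, shiftedEntropy μ m b (ρ' (e.symm r)) ∂(π.map e) := rfl
    _ = ∫⁻ x, shiftedEntropy μ m b (ρ x) ∂π := by
        rw [lintegral_map_equiv]
        refine lintegral_congr_ae ?_
        filter_upwards [hae] with x hx
        simp [hx]

theorem Ensemble.HasAverage.lintegral_qform {E : Ensemble H} {σ : H →L[ℂ] H} (h : E.HasAverage σ)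
    (φ : H) : ∫⁻ x, qform (E.ρ x) φ ∂E.π = qform σ φ :=
  lintegral_qform_of_average E.isState E.measurable h φ

end Averages

/-! ### Convexity -/

section Convexity

open ContinuousLinearMap

set_option linter.unusedSectionVars false

variable {H : Type*} [NormedAddCommGroup H] [InnerProductSpace ℂ H] [CompleteSpace H]
  {Y : Type*} [MeasurableSpace Y]

theorem isPositive_real_smul {T : H →L[ℂ] H} (hT : T.IsPositive) {t : ℝ} (ht : 0 ≤ t) :
    (t • T).IsPositive := by
  have := hT.smul_of_nonneg (c := (t : ℂ)) (by simpa using ht)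
  rwa [Complex.coe_smul] at this

theorem IsPOVMDensity.shiftedClosure_convex [TopologicalSpace.SeparableSpace H] {μ : Measure Y}
    [SFinite μ] {m : Y → H →L[ℂ] H} {b : ℝ} (hm : IsPOVMDensity μ m b) {ρ σ : H →L[ℂ] H}
    (hρ : ρ.IsPositive) (hσ : σ.IsPositive) {t : ℝ} (h0 : 0 ≤ t) (h1 : t ≤ 1) :
    shiftedClosure μ m b (t • ρ + (1 - t) • σ) ≤
      ENNReal.ofReal t * shiftedClosure μ m b ρ +
        ENNReal.ofReal (1 - t) * shiftedClosure μ m b σ := by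
  have key : ∀ (E : {E : Ensemble H // E.HasAverage ρ}) (F : {F : Ensemble H // F.HasAverage σ}),
      shiftedClosure μ m b (t • ρ + (1 - t) • σ) ≤
        ENNReal.ofReal t * (∫⁻ x, shiftedEntropy μ m b (E.1.ρ x) ∂E.1.π) +
        ENNReal.ofReal (1 - t) * ∫⁻ x, shiftedEntropy μ m b (F.1.ρ x) ∂F.1.π := by
    rintro ⟨E, hE⟩ ⟨F, hF⟩
    obtain ⟨x₀⟩ := E.π.nonempty_of_neZero
    obtain ⟨x₁⟩ := F.π.nonempty_of_neZero
    -- The product with `Bool` stands in for a disjoint union: the flag selects the ensemble, and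
    -- the unused coordinate is frozen at `x₁` or `x₀`.
    let f : E.X → E.X × F.X × Bool := fun x => (x, x₁, true)
    let g : F.X → E.X × F.X × Bool := fun x => (x₀, x, false)
    have hf : Measurable f := by fun_prop
    have hg : Measurable g := by fun_prop
    let π : Measure (E.X × F.X × Bool) :=
      ENNReal.ofReal t • E.π.map f + ENNReal.ofReal (1 - t) • F.π.map g
    let τ : E.X × F.X × Bool → H →L[ℂ] H := fun z => if z.2.2 then E.ρ z.1 else F.ρ z.2.1
    have hintegral : ∀ u : E.X × F.X × Bool → ℝ≥0∞, Measurable u → ∫⁻ z, u z ∂π =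
        ENNReal.ofReal t * (∫⁻ x, u (f x) ∂E.π) + ENNReal.ofReal (1 - t) * ∫⁻ x, u (g x) ∂F.π := by
      intro u hu
      rw [lintegral_add_measure, lintegral_smul_measure, lintegral_smul_measure,
        lintegral_map hu hf, lintegral_map hu hg, smul_eq_mul, smul_eq_mul]
    have hπ : IsProbabilityMeasure π := by
      constructor
      have := hintegral (fun _ => 1) measurable_const
      rw [lintegral_const, one_mul] at this
      rw [this]
      simp only [lintegral_const, measure_univ, mul_one]
      rw [← ENNReal.ofReal_add h0 (by linarith)]
      simp
    have hτ : ∀ z, IsState (τ z) := by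
      intro z
      by_cases hz : z.2.2 = true
      · simpa [τ, hz] using E.isState z.1
      · simpa [τ, hz] using F.isState z.2.1
    have hτm : MeasurableField τ := by
      intro φ ψ
      have : (fun z => ⟪φ, τ z ψ⟫_ℂ) = fun z : E.X × F.X × Bool =>
          if z.2.2 = true then ⟪φ, E.ρ z.1 ψ⟫_ℂ else ⟪φ, F.ρ z.2.1 ψ⟫_ℂ := by
        ext z
        by_cases hz : z.2.2 = true <;> simp [τ, hz]
      rw [this]
      refine Measurable.ite ?_ ((E.measurable φ ψ).comp measurable_fst)
        ((F.measurable φ ψ).comp (measurable_fst.comp measurable_snd))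
      exact (measurable_snd.comp measurable_snd) (measurableSet_singleton true)
    have hle := shiftedClosure_le_lintegral (π := π) (ρ := τ) (fun z => (hτ z).isPositive)
      (fun φ => hτm.measurable_qform φ) (.of_forall fun z => (isState_iff.1 (hτ z)).2)
      ((isPositive_real_smul hρ h0).add (isPositive_real_smul hσ (sub_nonneg.2 h1)))
      (fun φ => by
        rw [hintegral _ (hτm.measurable_qform φ), qform_add (isPositive_real_smul hρ h0)
          (isPositive_real_smul hσ (sub_nonneg.2 h1)), qform_smul h0,
          qform_smul (sub_nonneg.2 h1), ← hE.lintegral_qform, ← hF.lintegral_qform]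
        simp [τ, f, g]) μ m b
    rw [hintegral _ (hm.measurable_shiftedEntropy hτm (fun z => (hτ z).isPositive)
      fun z => (hτ z).trPos_ne_top)] at hle
    simpa [τ, f, g] using hle
  -- The endpoints are trivial. Otherwise both weights are nonzero and finite and pass inside the
  -- infima, which may be over empty families.
  rcases h0.eq_or_lt with rfl | h0'
  · simp
  rcases h1.eq_or_lt with rfl | h1'
  · simp
  conv_rhs =>
    rw [shiftedClosure, shiftedClosure, ENNReal.mul_iInf_of_ne (by simpa using h0') (by simp),
      ENNReal.mul_iInf_of_ne (by simpa using h1') (by simp)]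
  exact ENNReal.le_iInf_add_iInf key

/-- Distributivity can fail in `EReal`, so infinite values are treated separately; at the endpoints
`0 · ∞ = 0` is used. -/
theorem ereal_convex_sub {x y : ℝ≥0∞} {t c : ℝ} (h0 : 0 ≤ t) (h1 : t ≤ 1) :
    ((ENNReal.ofReal t * x + ENNReal.ofReal (1 - t) * y : ℝ≥0∞) : EReal) - (c : EReal) =
      (t : EReal) * ((x : EReal) - (c : EReal)) +
        ((1 - t : ℝ) : EReal) * ((y : EReal) - (c : EReal)) := by
  rcases h0.eq_or_lt with rfl | h0'
  · simp
  rcases h1.eq_or_lt with rfl | h1'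
  · simp
  have h2 : 0 < 1 - t := by linarith
  have hfin : ∀ z : NNReal, ∀ s : ℝ, (s : EReal) * ((z : EReal) - (c : EReal)) =
      ((s * ((z : ℝ) - c) : ℝ) : EReal) := fun z s => by
    rw [EReal.coe_nnreal_eq_coe_real]; norm_cast
  have htop : ∀ s : ℝ, 0 < s → (s : EReal) * (((∞ : ℝ≥0∞) : EReal) - (c : EReal)) = ⊤ :=
    fun s hs => by simp [EReal.coe_mul_top_of_pos hs]
  induction x using ENNReal.recTopCoe with
  | top =>
    rw [htop t h0', ENNReal.mul_top (by simpa using h0')]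
    induction y using ENNReal.recTopCoe with
    | top => rw [htop _ h2]; simp
    | coe y => rw [hfin, EReal.top_add_coe]; simp
  | coe x =>
    induction y using ENNReal.recTopCoe with
    | top =>
      rw [htop _ h2, hfin, ENNReal.mul_top (by simpa using h1'), EReal.coe_add_top]
      simp
    | coe y =>
      rw [hfin, hfin, EReal.coe_ennreal_add, EReal.coe_ennreal_mul, EReal.coe_ennreal_mul,
        EReal.coe_ennreal_ofReal, EReal.coe_ennreal_ofReal, max_eq_left h0, max_eq_left h2.le]
      rw [EReal.coe_nnreal_eq_coe_real, EReal.coe_nnreal_eq_coe_real]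
      norm_cast
      ring

end Convexity

/-! ### The weakly compact set of positive operators of trace at most one -/

section SubState

open ContinuousLinearMap Topology Filter
open scoped ComplexOrder

set_option linter.unusedSectionVars false

variable (H : Type*) [NormedAddCommGroup H] [InnerProductSpace ℂ H] [CompleteSpace H]

/-- Positive operators of trace at most one, with the weak operator topology. -/
@[ext]
structure SubState where
  op : H →L[ℂ] H
  isPositive : op.IsPositive
  trPos_le : trPos op ≤ 1

variable {H}

/-- The sesquilinear form of an operator. -/
def SubState.form (a : SubState H) (p : H × H) : ℂ := ⟪p.1, a.op p.2⟫_ℂ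

instance : TopologicalSpace (SubState H) := TopologicalSpace.induced SubState.form inferInstance

theorem SubState.isInducing_form : IsInducing (SubState.form (H := H)) := ⟨rfl⟩

theorem SubState.continuous_inner (φ ψ : H) : Continuous fun a : SubState H => ⟪φ, a.op ψ⟫_ℂ :=
  (continuous_apply (φ, ψ)).comp SubState.isInducing_form.continuous

theorem SubState.continuous_qform (φ : H) : Continuous fun a : SubState H => qform a.op φ :=
  ENNReal.continuous_ofReal.comp (Complex.continuous_re.comp (SubState.continuous_inner φ φ))

theorem norm_inner_le_of_trPos_le_one {T : H →L[ℂ] H} (hT : T.IsPositive) (h1 : trPos T ≤ 1)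
    (φ ψ : H) : ‖⟪φ, T ψ⟫_ℂ‖ ≤ ‖φ‖ * ‖ψ‖ := by
  have h := (norm_le_trPos hT).trans h1
  rw [← ofReal_norm, ENNReal.ofReal_le_one] at h
  exact (norm_inner_le_norm _ _).trans (mul_le_mul_of_nonneg_left
    ((T.le_of_opNorm_le h ψ).trans_eq (one_mul _)) (norm_nonneg _))

/-- A bounded sesquilinear form is the form of an operator. -/
theorem exists_operator_of_form (f : H × H → ℂ) (hb : ∀ φ ψ, ‖f (φ, ψ)‖ ≤ ‖φ‖ * ‖ψ‖)
    (hal : ∀ φ φ' ψ, f (φ + φ', ψ) = f (φ, ψ) + f (φ', ψ))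
    (har : ∀ φ ψ ψ', f (φ, ψ + ψ') = f (φ, ψ) + f (φ, ψ'))
    (hsl : ∀ (c : ℂ) φ ψ, f (c • φ, ψ) = starRingEnd ℂ c * f (φ, ψ))
    (hsr : ∀ (c : ℂ) φ ψ, f (φ, c • ψ) = c * f (φ, ψ)) :
    ∃ T : H →L[ℂ] H, ∀ φ ψ, ⟪φ, T ψ⟫_ℂ = f (φ, ψ) := by
  let B : H →L⋆[ℂ] H →L[ℂ] ℂ := LinearMap.mkContinuous₂
    (LinearMap.mk₂'ₛₗ (starRingEnd ℂ) (RingHom.id ℂ) (fun φ ψ => f (φ, ψ)) hal hsl har hsr) 1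
    fun φ ψ => by simpa using hb φ ψ
  refine ⟨adjoint (InnerProductSpace.continuousLinearMapOfBilin B), fun φ ψ => ?_⟩
  rw [adjoint_inner_right, InnerProductSpace.continuousLinearMapOfBilin_apply]
  rfl

/-- Each condition involves finitely many values of `f`, so it is closed for pointwise convergence.
The trace bound has this form because it is tested on finite partial sums; this is why trace at most
one, and not trace equal to one, is imposed. -/
theorem SubState.range_form : Set.range (SubState.form (H := H)) =
    {f | (∀ φ ψ, ‖f (φ, ψ)‖ ≤ ‖φ‖ * ‖ψ‖) ∧
      (∀ φ φ' ψ, f (φ + φ', ψ) = f (φ, ψ) + f (φ', ψ)) ∧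
      (∀ φ ψ ψ', f (φ, ψ + ψ') = f (φ, ψ) + f (φ, ψ')) ∧
      (∀ (c : ℂ) φ ψ, f (c • φ, ψ) = starRingEnd ℂ c * f (φ, ψ)) ∧
      (∀ (c : ℂ) φ ψ, f (φ, c • ψ) = c * f (φ, ψ)) ∧
      (∀ φ, 0 ≤ f (φ, φ)) ∧
      (∀ F : Finset (basisSet H), ∑ i ∈ F, (f (onb H i, onb H i)).re ≤ 1)} := by
  ext f
  constructor
  · rintro ⟨⟨T, hT, htr⟩, rfl⟩
    refine ⟨norm_inner_le_of_trPos_le_one hT htr, fun φ φ' ψ => inner_add_left _ _ _,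
      fun φ ψ ψ' => by simp [form], fun c φ ψ => inner_smul_left _ _ _,
      fun c φ ψ => by simp [form], fun φ => hT.inner_nonneg_right φ, fun F => ?_⟩
    simp only [form]
    rw [← ENNReal.ofReal_le_one, ENNReal.ofReal_sum_of_nonneg fun i _ => re_inner_nonneg hT _]
    exact (ENNReal.sum_le_tsum F).trans htr
  · rintro ⟨hb, hal, har, hsl, hsr, hpos, htr⟩
    obtain ⟨T, hT⟩ := exists_operator_of_form f hb hal har hsl hsr
    have hTp : T.IsPositive := by
      rw [isPositive_iff_complex]
      intro φ
      have h1 : 0 ≤ ⟪φ, T φ⟫_ℂ := by rw [hT]; exact hpos φ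
      have h2 : ⟪T φ, φ⟫_ℂ = ⟪φ, T φ⟫_ℂ := by
        rw [← inner_conj_symm, Complex.conj_eq_iff_im]
        exact ((Complex.le_def.1 h1).2).symm
      rw [h2]
      exact ⟨(Complex.eq_re_of_ofReal_le (r := 0) (by simpa using h1)).symm,
        (Complex.le_def.1 h1).1⟩
    refine ⟨⟨T, hTp, ?_⟩, funext fun p => hT p.1 p.2⟩
    rw [trPos, ENNReal.tsum_eq_iSup_sum]
    refine iSup_le fun F => ?_
    simp only [qform]
    rw [← ENNReal.ofReal_sum_of_nonneg fun i _ => re_inner_nonneg hTp _, ENNReal.ofReal_le_one]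
    simpa only [hT] using htr F

theorem SubState.isClosed_range_form : IsClosed (Set.range (SubState.form (H := H))) := by
  rw [SubState.range_form]
  simp only [Set.ofPred_and, Set.ofPred_forall]
  refine IsClosed.inter ?_ (IsClosed.inter ?_ (IsClosed.inter ?_ (IsClosed.inter ?_
    (IsClosed.inter ?_ (IsClosed.inter ?_ ?_)))))
  · exact isClosed_iInter fun φ => isClosed_iInter fun ψ =>
      isClosed_le (by fun_prop) (by fun_prop)
  · exact isClosed_iInter fun φ => isClosed_iInter fun ψ => isClosed_iInter fun ψ =>
      isClosed_eq (by fun_prop) (by fun_prop)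
  · exact isClosed_iInter fun φ => isClosed_iInter fun ψ => isClosed_iInter fun ψ =>
      isClosed_eq (by fun_prop) (by fun_prop)
  · exact isClosed_iInter fun φ => isClosed_iInter fun ψ => isClosed_iInter fun ψ =>
      isClosed_eq (by fun_prop) (by fun_prop)
  · exact isClosed_iInter fun φ => isClosed_iInter fun ψ => isClosed_iInter fun ψ =>
      isClosed_eq (by fun_prop) (by fun_prop)
  · exact isClosed_iInter fun φ => isClosed_le (by fun_prop) (by fun_prop)
  · exact isClosed_iInter fun F => isClosed_le (by fun_prop) (by fun_prop)

instance : CompactSpace (SubState H) := by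
  constructor
  -- Banach-Alaoglu argument: the forms are a closed subset of a product of closed discs, compact by
  -- Tychonoff.
  rw [SubState.isInducing_form.isCompact_iff, Set.image_univ]
  refine IsCompact.of_isClosed_subset (isCompact_univ_pi fun p : H × H =>
    isCompact_closedBall (0 : ℂ) (‖p.1‖ * ‖p.2‖)) SubState.isClosed_range_form ?_
  rintro _ ⟨a, rfl⟩ p -
  simpa [SubState.form] using norm_inner_le_of_trPos_le_one a.isPositive a.trPos_le p.1 p.2

/-- The matrix of an operator in the fixed basis. -/
def SubState.entries (a : SubState H) (i j : basisSet H) : ℂ := ⟪onb H i, a.op (onb H j)⟫_ℂ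

theorem SubState.continuous_entries : Continuous (SubState.entries (H := H)) :=
  continuous_pi fun _ => continuous_pi fun _ => SubState.continuous_inner _ _

theorem eq_of_basis {ι : Type*} (b : HilbertBasis ι ℂ H) {T S : H →L[ℂ] H}
    (h : ∀ i j, ⟪b i, T (b j)⟫_ℂ = ⟪b i, S (b j)⟫_ℂ) : T = S := by
  refine ext_on (s := Set.range b) (Submodule.dense_iff_topologicalClosure_eq_top.2 b.dense_span) ?_
  rintro _ ⟨j, rfl⟩
  refine b.repr.injective ?_
  ext i
  simpa only [b.repr_apply_apply] using h i j

theorem SubState.entries_injective : Function.Injective (SubState.entries (H := H)) :=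
  fun _ _ h => SubState.ext (eq_of_basis (onb H) fun i j => congrFun (congrFun h i) j)

/-- A continuous injection of a compact space into a Hausdorff one. In the separable case the matrix
has countably many entries, which makes `SubState H` Polish. -/
theorem SubState.isClosedEmbedding_entries : IsClosedEmbedding (SubState.entries (H := H)) :=
  SubState.continuous_entries.isClosedEmbedding SubState.entries_injective

instance : MeasurableSpace (SubState H) := borel _

instance : BorelSpace (SubState H) := ⟨rfl⟩

instance : T2Space (SubState H) :=
  SubState.isClosedEmbedding_entries.isEmbedding.t2Space

variable [TopologicalSpace.SeparableSpace H]

instance : PolishSpace (SubState H) := SubState.isClosedEmbedding_entries.polishSpace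

theorem SubState.measurable_mk {X : Type*} [MeasurableSpace X] {f : X → SubState H}
    (hf : MeasurableField fun x => (f x).op) : Measurable f := by
  rw [← SubState.isClosedEmbedding_entries.measurableEmbedding.measurable_comp_iff]
  exact measurable_pi_iff.2 fun i => measurable_pi_iff.2 fun j => hf _ _

theorem SubState.measurableField : MeasurableField fun a : SubState H => a.op :=
  fun φ ψ => (SubState.continuous_inner φ ψ).measurable

/-- The states, as a subset of the compact set of positive operators of trace at most one. -/
def stateSet (H : Type*) [NormedAddCommGroup H] [InnerProductSpace ℂ H] [CompleteSpace H] :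
    Set (SubState H) := {a | trPos a.op = 1}

theorem measurableSet_stateSet : MeasurableSet (stateSet H) :=
  measurable_trPos SubState.measurableField (measurableSet_singleton 1)

/-- The pairing is a sum of the nonnegative continuous functions `⟨√m eᵢ, T √m eᵢ⟩`. -/
theorem lowerSemicontinuous_trPair {m : H →L[ℂ] H} (hm : m.IsPositive) :
    LowerSemicontinuous fun a : SubState H => trPair a.op m := by
  simp_rw [fun a : SubState H => trPair_eq (onb H) a.isPositive hm]
  exact lowerSemicontinuous_tsum fun i => (SubState.continuous_qform _).lowerSemicontinuous

theorem isPositive_sub_of_norm_le {m : H →L[ℂ] H} (hm : m.IsPositive) {b : ℝ} (hb : ‖m‖ ≤ b) :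
    (b • (1 : H →L[ℂ] H) - m).IsPositive := by
  have hp := isPositive_real_smul (isPositive_one (𝕜 := ℂ) (E := H)) ((norm_nonneg m).trans hb)
  refine ⟨hp.isSymmetric.sub hm.isSymmetric, fun φ => ?_⟩
  have h1 : ‖⟪m φ, φ⟫_ℂ‖ ≤ b * ‖φ‖ * ‖φ‖ := (norm_inner_le_norm _ _).trans
    (mul_le_mul_of_nonneg_right (m.le_of_opNorm_le hb φ) (norm_nonneg _))
  have h2 := (Complex.re_le_norm _).trans h1
  have h3 : (⟪φ, φ⟫_ℂ).re = ‖φ‖ * ‖φ‖ := inner_self_eq_norm_mul_norm (𝕜 := ℂ) φ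
  simp only [reApplyInnerSelf_apply, sub_apply, smul_apply, inner_sub_left,
    inner_smul_left_eq_smul, map_sub]
  change 0 ≤ (b • ⟪φ, φ⟫_ℂ).re - (⟪m φ, φ⟫_ℂ).re
  rw [Complex.smul_re, h3, smul_eq_mul]
  linarith

theorem trPair_add (T : H →L[ℂ] H) {m n : H →L[ℂ] H} (hm : m.IsPositive) (hn : n.IsPositive) :
    trPair T (m + n) = trPair T m + trPair T n := by
  simp_rw [trPair, qform_add hm hn, ENNReal.tsum_add]

theorem trPair_add_trPair_sub {T m : H →L[ℂ] H} (hT : T.IsPositive) (hm : m.IsPositive) {b : ℝ}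
    (hb : ‖m‖ ≤ b) :
    trPair T m + trPair T (b • (1 : H →L[ℂ] H) - m) = ENNReal.ofReal b * trPos T := by
  rw [← trPair_add T hm (isPositive_sub_of_norm_le hm hb), add_sub_cancel, ← trPair_one hT]
  simp_rw [trPair, qform_smul ((norm_nonneg m).trans hb), ENNReal.tsum_mul_left]

/-- On states the pairings with `m` and with `‖m‖ · 1 - m ≥ 0` have the constant sum `‖m‖`. Both are
lower semicontinuous, hence both are continuous. -/
theorem continuous_trPair_stateSet {m : H →L[ℂ] H} (hm : m.IsPositive) :
    Continuous fun a : stateSet H => trPair a.1.op m := by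
  have hl : LowerSemicontinuous fun a : stateSet H => trPair a.1.op m :=
    (lowerSemicontinuous_trPair hm).comp continuous_subtype_val
  have hl' : LowerSemicontinuous fun a : stateSet H => trPair a.1.op (‖m‖ • (1 : H →L[ℂ] H) - m) :=
    (lowerSemicontinuous_trPair (isPositive_sub_of_norm_le hm le_rfl)).comp continuous_subtype_val
  have hsum : ∀ a : stateSet H, trPair a.1.op m + trPair a.1.op (‖m‖ • (1 : H →L[ℂ] H) - m) =
      ENNReal.ofReal ‖m‖ := fun a => by
    rw [trPair_add_trPair_sub a.1.isPositive hm le_rfl, a.2, mul_one]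
  refine continuous_iff_lower_upperSemicontinuous.2 ⟨hl, fun a c hc => ?_⟩
  rcases lt_or_ge (ENNReal.ofReal ‖m‖) c with h | h
  · exact .of_forall fun a' => (le_self_add.trans_eq (hsum a')).trans_lt h
  have hfin : ∀ a : stateSet H, trPair a.1.op (‖m‖ • (1 : H →L[ℂ] H) - m) ≠ ∞ := fun a =>
    ((le_add_self.trans_eq (hsum a)).trans_lt ENNReal.ofReal_lt_top).ne
  have hca : ENNReal.ofReal ‖m‖ - c < trPair a.1.op (‖m‖ • (1 : H →L[ℂ] H) - m) := by
    rw [ENNReal.sub_lt_iff_lt_right (h.trans_lt ENNReal.ofReal_lt_top).ne h, ← hsum a, add_comm]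
    exact ENNReal.add_lt_add_left (hfin a) hc
  filter_upwards [hl' a _ hca] with a' ha'
  rw [gt_iff_lt, ENNReal.sub_lt_iff_lt_right (h.trans_lt ENNReal.ofReal_lt_top).ne h,
    ← hsum a', add_comm] at ha'
  exact lt_of_add_lt_add_left ha'

end SubState

/-! ### Lower semicontinuity -/

section LowerSemicontinuity

open ContinuousLinearMap Topology Filter

set_option linter.unusedSectionVars false

variable {H : Type*} [NormedAddCommGroup H] [InnerProductSpace ℂ H] [CompleteSpace H]
  [TopologicalSpace.SeparableSpace H] {Y : Type*} [MeasurableSpace Y]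

/-- The map from the index space of an ensemble to the set of states. -/
def Ensemble.toStateSet (E : Ensemble H) (x : E.X) : stateSet H :=
  ⟨⟨E.ρ x, (E.isState x).isPositive, (isState_iff.1 (E.isState x)).2.le⟩,
    (isState_iff.1 (E.isState x)).2⟩

theorem Ensemble.measurable_toStateSet (E : Ensemble H) : Measurable E.toStateSet :=
  Measurable.subtype_mk (f := fun x => (E.toStateSet x : SubState H))
    (SubState.measurable_mk (f := fun x => (E.toStateSet x : SubState H)) E.measurable)

/-- The distribution of an ensemble on the compact set of positive operators of trace at most
one. -/
def Ensemble.law (E : Ensemble H) : ProbabilityMeasure (SubState H) :=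
  ⟨E.π.map fun x => (E.toStateSet x : SubState H), Measure.isProbabilityMeasure_map
    (measurable_subtype_coe.comp E.measurable_toStateSet).aemeasurable⟩

theorem Ensemble.lintegral_law (E : Ensemble H) {f : SubState H → ℝ≥0∞} (hf : Measurable f) :
    ∫⁻ a, f a ∂(E.law : Measure (SubState H)) = ∫⁻ x, f (E.toStateSet x) ∂E.π :=
  lintegral_map hf (measurable_subtype_coe.comp E.measurable_toStateSet)

/-- Quadratic forms are continuous on a compact space, hence bounded, and so are test functions for
weak convergence. -/
theorem lintegral_qform_of_tendsto {ν : ℕ → ProbabilityMeasure (SubState H)}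
    {ν' : ProbabilityMeasure (SubState H)} (h : Tendsto ν atTop (𝓝 ν')) (φ : H) :
    Tendsto (fun n => ∫⁻ a, qform a.op φ ∂(ν n : Measure (SubState H))) atTop
      (𝓝 (∫⁻ a, qform a.op φ ∂(ν' : Measure (SubState H)))) := by
  have hc : Continuous fun a : SubState H => (qform a.op φ).toNNReal :=
    ENNReal.continuousOn_toNNReal.comp_continuous (SubState.continuous_qform φ)
      fun a => qform_ne_top _ _
  have := ProbabilityMeasure.tendsto_iff_forall_lintegral_tendsto.1 h
    (BoundedContinuousFunction.mkOfCompact ⟨_, hc⟩)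
  simpa [ENNReal.coe_toNNReal (qform_ne_top _ _)] using this

/-- A probability measure on the positive operators of trace at most one whose average is a state
is concentrated on the states. -/
theorem ae_trPos_eq_one {ν : Measure (SubState H)} [IsProbabilityMeasure ν] {ρ : H →L[ℂ] H}
    (hρ : IsState ρ) (h : ∀ φ, ∫⁻ a, qform a.op φ ∂ν = qform ρ φ) :
    ∀ᵐ a ∂ν, trPos a.op = 1 := by
  have h1 : ∫⁻ a, trPos a.op ∂ν = 1 := by
    simp only [trPos]
    rw [lintegral_tsum fun i => (SubState.continuous_qform _).measurable.aemeasurable]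
    simp_rw [h]
    exact (isState_iff.1 hρ).2
  -- The mean trace is the trace of the average, namely one; since the trace never exceeds one, it
  -- equals one almost everywhere.
  have h2 := ae_eq_of_ae_le_of_lintegral_le (μ := ν) (f := fun a => trPos a.op) (g := fun _ => 1)
    (.of_forall fun a => a.trPos_le) (by simp [h1]) aemeasurable_const (by simp [h1])
  exact h2

/-- After Tonelli, the portmanteau inequality holds for each fixed outcome, where the integrand is
continuous and nonnegative on states; Fatou over the outcomes finishes. -/
theorem IsPOVMDensity.lintegral_shiftedEntropy_le_liminf {μ : Measure Y} [SFinite μ]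
    {m : Y → H →L[ℂ] H} {b : ℝ} (hm : IsPOVMDensity μ m b)
    {ν : Measure (stateSet H)} [SFinite ν] {νs : ℕ → Measure (stateSet H)} [∀ n, SFinite (νs n)]
    (h : ∀ G, IsOpen G → ν G ≤ atTop.liminf fun n => νs n G) :
    ∫⁻ a, shiftedEntropy μ m b a.1.op ∂ν ≤
      atTop.liminf fun n => ∫⁻ a, shiftedEntropy μ m b a.1.op ∂(νs n) := by
  have hmeas : Measurable fun z : stateSet H × Y =>
      ENNReal.ofReal (entFun b (trPair z.1.1.op (m z.2)).toReal) :=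
    hm.measurable_entFun_trPair (ρ := fun a : stateSet H => a.1.op)
      (SubState.measurableField.comp measurable_subtype_coe) (fun a => a.1.isPositive)
      fun a => (a.1.trPos_le.trans_lt ENNReal.one_lt_top).ne
  have hswap : ∀ ν : Measure (stateSet H), SFinite ν → ∫⁻ a, shiftedEntropy μ m b a.1.op ∂ν =
      ∫⁻ y, ∫⁻ a, ENNReal.ofReal (entFun b (trPair a.1.op (m y)).toReal) ∂ν ∂μ := fun ν _ => by
    simp only [shiftedEntropy]
    exact lintegral_lintegral_swap (f := fun (a : stateSet H) (y : Y) =>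
      ENNReal.ofReal (entFun b (trPair a.1.op (m y)).toReal)) hmeas.aemeasurable
  rw [hswap ν inferInstance]
  simp_rw [fun n => hswap (νs n) inferInstance]
  refine (lintegral_mono fun y => ?_).trans (lintegral_liminf_le fun n => ?_)
  · have hc : Continuous fun a : stateSet H => (trPair a.1.op (m y)).toReal :=
      ENNReal.continuousOn_toReal.comp_continuous (continuous_trPair_stateSet (hm.isPositive y))
        fun a => trPair_ne_top a.1.isPositive (a.1.trPos_le.trans_lt ENNReal.one_lt_top).ne
    exact lintegral_le_liminf_lintegral_of_forall_isOpen_measure_le_liminf_measure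
      ((continuous_entFun b).comp hc) (fun a => entFun_nonneg ENNReal.toReal_nonneg
        (hm.trPair_toReal_le (isState_iff.2 ⟨a.1.isPositive, a.2⟩) y)) h
  · exact hmeas.lintegral_prod_left'

/-- Only convergence of quadratic forms is needed: compactness supplies a limit ensemble, and the
unit trace of `ρ` prevents loss of mass. -/
theorem IsPOVMDensity.shiftedClosure_le_of_tendsto {μ : Measure Y} [SFinite μ]
    {m : Y → H →L[ℂ] H} {b : ℝ} (hm : IsPOVMDensity μ m b) {ρ : H →L[ℂ] H} (hρ : IsState ρ)
    {σ : ℕ → H →L[ℂ] H} (hσ : ∀ φ, Tendsto (fun n => qform (σ n) φ) atTop (𝓝 (qform ρ φ)))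
    {C : ℝ≥0∞} (h : ∀ n, shiftedClosure μ m b (σ n) < C) : shiftedClosure μ m b ρ ≤ C := by
  have h' : ∀ n, ∃ E : Ensemble H, E.HasAverage (σ n) ∧
      ∫⁻ x, shiftedEntropy μ m b (E.ρ x) ∂E.π < C := fun n => by
    obtain ⟨⟨E, hE⟩, hlt⟩ := iInf_lt_iff.1 (h n)
    exact ⟨E, hE, hlt⟩
  choose E hE hEC using h'
  obtain ⟨ν, k, hk, hν⟩ := CompactSpace.tendsto_subseq fun n => (E n).law
  have havg : ∀ φ, ∫⁻ a, qform a.op φ ∂(ν : Measure (SubState H)) = qform ρ φ := by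
    intro φ
    refine tendsto_nhds_unique (lintegral_qform_of_tendsto hν φ) ?_
    convert (hσ φ).comp hk.tendsto_atTop using 2 with n
    change ∫⁻ a, qform a.op φ ∂((E (k n)).law : Measure (SubState H)) = _
    rw [(E (k n)).lintegral_law (SubState.continuous_qform φ).measurable]
    exact (hE (k n)).lintegral_qform φ
  have hae := ae_trPos_eq_one hρ havg
  refine (shiftedClosure_le_lintegral (π := (ν : Measure (SubState H))) (ρ := SubState.op)
    (fun a => a.isPositive) (fun φ => (SubState.continuous_qform φ).measurable) hae hρ.isPositive
    havg μ m b).trans ?_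
  have hemb := MeasurableEmbedding.subtype_coe (measurableSet_stateSet (H := H))
  -- Continuity of the output density is available only on the subspace of states, so the limit law
  -- is moved there.
  let ν' : Measure (stateSet H) := (ν : Measure (SubState H)).comap Subtype.val
  have : IsFiniteMeasure ν' := ⟨by rw [hemb.comap_apply]; exact measure_lt_top _ _⟩
  have : ∀ n, IsProbabilityMeasure ((E n).π.map (E n).toStateSet) := fun n =>
    Measure.isProbabilityMeasure_map (E n).measurable_toStateSet.aemeasurable
  have hmeas : Measurable fun a : stateSet H => shiftedEntropy μ m b a.1.op :=
    hm.measurable_shiftedEntropy (SubState.measurableField.comp measurable_subtype_coe)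
      (fun a => a.1.isPositive) fun a => (a.1.trPos_le.trans_lt ENNReal.one_lt_top).ne
  have hopen : ∀ G : Set (stateSet H), IsOpen G → ν' G ≤
      atTop.liminf fun n => (E (k n)).π.map (E (k n)).toStateSet G := by
    -- An open set of states is the trace of an open `V`, and the approximating laws live on states,
    -- so the portmanteau bound for `V` suffices.
    rintro _ ⟨V, hV, rfl⟩
    have h1 := ProbabilityMeasure.le_liminf_measure_open_of_tendsto hν hV
    calc ν' (Subtype.val ⁻¹' V) ≤ (ν : Measure (SubState H)) V := by
          rw [hemb.comap_apply]
          exact measure_mono (Set.image_preimage_subset _ _)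
      _ ≤ _ := h1
      _ = _ := by
          congr with n
          change (E (k n)).π.map (fun x => ((E (k n)).toStateSet x : SubState H)) V = _
          rw [Measure.map_apply (E (k n)).measurable_toStateSet
            (measurable_subtype_coe hV.measurableSet)]
          exact Measure.map_apply (measurable_subtype_coe.comp (E (k n)).measurable_toStateSet)
            hV.measurableSet
  have hfatou := hm.lintegral_shiftedEntropy_le_liminf (ν := ν')
    (νs := fun n => (E (k n)).π.map (E (k n)).toStateSet) hopen
  calc ∫⁻ a, shiftedEntropy μ m b a.op ∂(ν : Measure (SubState H))
      = ∫⁻ a in stateSet H, shiftedEntropy μ m b a.op ∂(ν : Measure (SubState H)) := by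
        rw [Measure.restrict_eq_self_of_ae_mem]
        exact hae
    _ = ∫⁻ a, shiftedEntropy μ m b a.1.op ∂ν' := by
        exact (lintegral_subtype_comap measurableSet_stateSet
          fun a : SubState H => shiftedEntropy μ m b a.op).symm
    _ ≤ _ := hfatou
    _ ≤ C := by
        refine liminf_le_of_le (by isBoundedDefault) fun c hc => ?_
        obtain ⟨n, hn⟩ := hc.exists
        rw [lintegral_map hmeas (E (k n)).measurable_toStateSet] at hn
        exact hn.trans (hEC (k n)).le

theorem tendsto_qform_of_traceNorm {ρ : H →L[ℂ] H} {σ : ℕ → H →L[ℂ] H}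
    (h : Tendsto (fun n => traceNorm (σ n - ρ)) atTop (𝓝 0)) (φ : H) :
    Tendsto (fun n => qform (σ n) φ) atTop (𝓝 (qform ρ φ)) := by
  have h1 : Tendsto (fun n => ‖σ n - ρ‖ₑ) atTop (𝓝 0) :=
    tendsto_of_tendsto_of_tendsto_of_le_of_le tendsto_const_nhds h (fun n => zero_le)
      fun n => norm_le_traceNorm _
  have h2 : Tendsto σ atTop (𝓝 ρ) := by
    rw [tendsto_iff_edist_tendsto_0]
    simpa only [edist_eq_enorm_sub] using h1
  have h3 : Continuous fun T : H →L[ℂ] H => qform T φ := by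
    exact ENNReal.continuous_ofReal.comp (by fun_prop)
  exact (h3.tendsto ρ).comp h2

theorem IsPOVMDensity.lowerSemicontinuous_convexClosure {μ : Measure Y} [SFinite μ]
    {m : Y → H →L[ℂ] H} {b : ℝ} (hb : 1 ≤ b) (hm : IsPOVMDensity μ m b) {ρ : H →L[ℂ] H}
    (hρ : IsState ρ) {c : EReal} (hc : c < convexClosure μ m ρ) :
    ∃ δ : ℝ≥0∞, 0 < δ ∧ ∀ σ : H →L[ℂ] H, IsState σ → traceNorm (σ - ρ) < δ →
      c < convexClosure μ m σ := by
  by_contra! hcon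
  -- The intermediate level makes the bound on the sequence strict, so that ensembles below it
  -- exist, yet keeps it strictly below the value at `ρ`.
  obtain ⟨c', hcc', hc'⟩ := exists_between hc
  have hcon' : ∀ n : ℕ, ∃ σ : H →L[ℂ] H, traceNorm (σ - ρ) < (n + 1 : ℝ≥0∞)⁻¹ ∧
      convexClosure μ m σ ≤ c := fun n => by
    obtain ⟨σ, -, h1, h2⟩ := hcon ((n + 1 : ℝ≥0∞)⁻¹) (by simp)
    exact ⟨σ, h1, h2⟩
  choose σ hσ hσc using hcon'
  have hlim : Tendsto (fun n => traceNorm (σ n - ρ)) atTop (𝓝 0) := by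
    refine tendsto_of_tendsto_of_tendsto_of_le_of_le tendsto_const_nhds
      ((tendsto_add_atTop_iff_nat 1).2 ENNReal.tendsto_inv_nat_nhds_zero) (fun n => zero_le)
      fun n => ?_
    simpa using (hσ n).le
  have hsub : ∀ τ : H →L[ℂ] H, convexClosure μ m τ + (Real.log b : EReal) =
      (shiftedClosure μ m b τ : EReal) := fun τ => by
    rw [hm.convexClosure_eq hb, EReal.sub_add_cancel]
  have hlt : ∀ n, (shiftedClosure μ m b (σ n) : EReal) < c' + (Real.log b : EReal) := fun n => by
    rw [← hsub]
    exact EReal.add_lt_add_right_coe ((hσc n).trans_lt hcc') _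
  have hlt' : c' + (Real.log b : EReal) < (shiftedClosure μ m b ρ : EReal) := by
    rw [← hsub]
    exact EReal.add_lt_add_right_coe hc' _
  have h0 : 0 ≤ c' + (Real.log b : EReal) := (EReal.coe_ennreal_nonneg _).trans (hlt 0).le
  have hC := EReal.coe_toENNReal h0
  rw [← hC] at hlt'
  refine absurd (hm.shiftedClosure_le_of_tendsto (b := b) hρ (tendsto_qform_of_traceNorm hlim)
    (C := (c' + (Real.log b : EReal)).toENNReal) fun n => ?_)
    (not_le.2 (EReal.coe_ennreal_lt_coe_ennreal_iff.1 hlt'))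
  have := hlt n
  rw [← hC] at this
  exact EReal.coe_ennreal_lt_coe_ennreal_iff.1 this

end LowerSemicontinuity

/-! ### Operators on Hilbert space tensor products -/

section TensorOperators

open ContinuousLinearMap

set_option linter.unusedSectionVars false

variable {H₁ H₂ : Type*}
  [NormedAddCommGroup H₁] [InnerProductSpace ℂ H₁] [CompleteSpace H₁]
  [NormedAddCommGroup H₂] [InnerProductSpace ℂ H₂] [CompleteSpace H₂]

/-- The product vector `x ⊗ y` in the Hilbert space tensor product. -/
def htmul (x : H₁) (y : H₂) : HTensor H₁ H₂ := ((x ⊗ₜ[ℂ] y : H₁ ⊗[ℂ] H₂) : HTensor H₁ H₂)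

theorem tensorRight_apply (f : H₂) (x : H₁) : tensorRight f x = htmul x f := rfl

theorem tensorLeft_apply (e : H₁) (y : H₂) : tensorLeft e y = htmul e y := rfl

theorem inner_htmul (x x' : H₁) (y y' : H₂) :
    ⟪htmul x y, htmul x' y'⟫_ℂ = ⟪x, x'⟫_ℂ * ⟪y, y'⟫_ℂ := by
  rw [htmul, htmul, UniformSpace.Completion.inner_coe, TensorProduct.inner_tmul]

theorem opTensor_htmul (A : H₁ →L[ℂ] H₁) (B : H₂ →L[ℂ] H₂) (x : H₁) (y : H₂) :
    opTensor A B (htmul x y) = htmul (A x) (B y) := by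
  rw [opTensor, htmul, completion_apply_coe, TensorProduct.mapL_tmul]
  rfl

theorem eq_zero_of_inner_htmul {v : HTensor H₁ H₂} (h : ∀ x y, ⟪htmul x y, v⟫_ℂ = 0) : v = 0 := by
  have h1 : ∀ t : H₁ ⊗[ℂ] H₂, ⟪(t : HTensor H₁ H₂), v⟫_ℂ = 0 := by
    intro t
    induction t using TensorProduct.induction_on with
    | zero => rw [UniformSpace.Completion.coe_zero, inner_zero_left]
    | tmul x y => exact h x y
    | add t s ht hs => rw [UniformSpace.Completion.coe_add, inner_add_left, ht, hs, add_zero]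
  have h2 : ∀ w : HTensor H₁ H₂, ⟪w, v⟫_ℂ = 0 := fun w =>
    UniformSpace.Completion.induction_on w
      (isClosed_eq (by fun_prop) continuous_const) h1
  exact inner_self_eq_zero.1 (h2 v)

theorem opTensor_ext {A B : HTensor H₁ H₂ →L[ℂ] HTensor H₁ H₂}
    (h : ∀ x y, A (htmul x y) = B (htmul x y)) : A = B := by
  have h1 : ∀ t : H₁ ⊗[ℂ] H₂, A t = B t := by
    intro t
    induction t using TensorProduct.induction_on with
    | zero => rw [UniformSpace.Completion.coe_zero, map_zero, map_zero]
    | tmul x y => exact h x y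
    | add t s ht hs => rw [UniformSpace.Completion.coe_add, map_add, map_add, ht, hs]
  ext w
  exact UniformSpace.Completion.induction_on w
      (isClosed_eq (by fun_prop) (by fun_prop)) h1

theorem opTensor_comp (A A' : H₁ →L[ℂ] H₁) (B B' : H₂ →L[ℂ] H₂) :
    opTensor A B ∘L opTensor A' B' = opTensor (A ∘L A') (B ∘L B') :=
  opTensor_ext fun x y => by simp [opTensor_htmul]

theorem adjoint_opTensor (A : H₁ →L[ℂ] H₁) (B : H₂ →L[ℂ] H₂) :
    adjoint (opTensor A B) = opTensor (adjoint A) (adjoint B) := by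
  refine opTensor_ext fun x y => sub_eq_zero.1 (eq_zero_of_inner_htmul fun x' y' => ?_)
  rw [inner_sub_right, adjoint_inner_right, opTensor_htmul, opTensor_htmul, inner_htmul,
    inner_htmul, adjoint_inner_right, adjoint_inner_right, sub_self]

theorem opTensor_one_one : opTensor (1 : H₁ →L[ℂ] H₁) (1 : H₂ →L[ℂ] H₂) = 1 :=
  opTensor_ext fun x y => by simp [opTensor_htmul]

theorem norm_opTensor_le (A : H₁ →L[ℂ] H₁) (B : H₂ →L[ℂ] H₂) :
    ‖opTensor A B‖ ≤ ‖A‖ * ‖B‖ := by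
  refine opNorm_le_bound _ (by positivity) fun w => ?_
  refine UniformSpace.Completion.induction_on w
    (isClosed_le (by fun_prop) (by fun_prop)) fun t => ?_
  rw [opTensor, completion_apply_coe, UniformSpace.Completion.norm_coe,
    UniformSpace.Completion.norm_coe]
  exact (TensorProduct.mapL A B).le_of_opNorm_le (TensorProduct.norm_mapL_le A B) t

theorem opTensor_eq_sqrt_comp_adjoint {A : H₁ →L[ℂ] H₁} {B : H₂ →L[ℂ] H₂} (hA : A.IsPositive)
    (hB : B.IsPositive) : opTensor (CFC.sqrt A) (CFC.sqrt B) ∘L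
      adjoint (opTensor (CFC.sqrt A) (CFC.sqrt B)) = opTensor A B := by
  rw [adjoint_opTensor, opTensor_comp, sqrt_comp_adjoint_sqrt hA, sqrt_comp_adjoint_sqrt hB]

theorem isPositive_opTensor {A : H₁ →L[ℂ] H₁} {B : H₂ →L[ℂ] H₂} (hA : A.IsPositive)
    (hB : B.IsPositive) : (opTensor A B).IsPositive := by
  rw [← opTensor_eq_sqrt_comp_adjoint hA hB]
  exact isPositive_self_comp_adjoint _

theorem orthonormal_htmul {ι κ : Type*} (b : HilbertBasis ι ℂ H₁) (c : HilbertBasis κ ℂ H₂) :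
    Orthonormal ℂ fun p : ι × κ => htmul (b p.1) (c p.2) := by
  classical
  rw [orthonormal_iff_ite]
  rintro ⟨i, j⟩ ⟨i', j'⟩
  rw [inner_htmul, orthonormal_iff_ite.1 b.orthonormal, orthonormal_iff_ite.1 c.orthonormal]
  by_cases h1 : i = i' <;> by_cases h2 : j = j' <;> simp [h1, h2]

theorem eq_zero_of_inner_basis {H ι : Type*} [NormedAddCommGroup H] [InnerProductSpace ℂ H]
    (b : HilbertBasis ι ℂ H) {v : H} (h : ∀ i, ⟪b i, v⟫_ℂ = 0) : v = 0 := by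
  refine b.repr.injective ?_
  ext i
  simp [b.repr_apply_apply, h]

/-- The Hilbert basis of product vectors. -/
def prodBasis {ι κ : Type*} (b : HilbertBasis ι ℂ H₁) (c : HilbertBasis κ ℂ H₂) :
    HilbertBasis (ι × κ) ℂ (HTensor H₁ H₂) :=
  HilbertBasis.mkOfOrthogonalEqBot (orthonormal_htmul b c) <| by
    rw [Submodule.eq_bot_iff]
    intro v hv
    rw [Submodule.mem_orthogonal] at hv
    have h0 : ∀ i j, ⟪htmul (b i) (c j), v⟫_ℂ = 0 := fun i j =>
      hv _ (Submodule.subset_span ⟨(i, j), rfl⟩)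
    have h1 : ∀ x j, ⟪htmul x (c j), v⟫_ℂ = 0 := by
      -- The basis vectors are replaced by arbitrary ones one factor at a time: the partial inner
      -- product of `v` with `c j` is orthogonal to the whole basis `b`, hence zero.
      intro x j
      have : adjoint (tensorRight (c j)) v = 0 := eq_zero_of_inner_basis b fun i => by
        rw [adjoint_inner_right, tensorRight_apply, h0]
      rw [← tensorRight_apply, ← adjoint_inner_right, this, inner_zero_right]
    refine eq_zero_of_inner_htmul fun x y => ?_
    have : adjoint (tensorLeft x) v = 0 := eq_zero_of_inner_basis c fun j => by
      rw [adjoint_inner_right, tensorLeft_apply, h1]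
    rw [← tensorLeft_apply, ← adjoint_inner_right, this, inner_zero_right]

theorem prodBasis_apply {ι κ : Type*} (b : HilbertBasis ι ℂ H₁) (c : HilbertBasis κ ℂ H₂)
    (p : ι × κ) : prodBasis b c p = htmul (b p.1) (c p.2) := by
  rw [prodBasis, HilbertBasis.coe_mkOfOrthogonalEqBot]

instance [TopologicalSpace.SeparableSpace H₁] [TopologicalSpace.SeparableSpace H₂] :
    TopologicalSpace.SeparableSpace (HTensor H₁ H₂) := by
  rw [← TopologicalSpace.isSeparable_univ_iff]
  have h := (Set.countable_range (prodBasis (onb H₁) (onb H₂))).isSeparable.span (R := ℂ) |>.closure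
  have h2 := (prodBasis (onb H₁) (onb H₂)).dense_span
  rw [← Submodule.topologicalClosure_coe, h2] at h
  exact h

theorem qform_opTensor_htmul {A : H₁ →L[ℂ] H₁} {B : H₂ →L[ℂ] H₂} (hA : A.IsPositive)
    (hB : B.IsPositive) (x : H₁) (y : H₂) :
    qform (opTensor A B) (htmul x y) = qform A x * qform B y := by
  rw [qform, opTensor_htmul, inner_htmul, ← ofReal_qform hA, ← ofReal_qform hB,
    ← Complex.ofReal_mul, Complex.ofReal_re, ENNReal.ofReal_mul ENNReal.toReal_nonneg,
    ENNReal.ofReal_toReal (qform_ne_top _ _), ENNReal.ofReal_toReal (qform_ne_top _ _)]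

theorem adjoint_one : adjoint (1 : H₁ →L[ℂ] H₁) = 1 :=
  (IsSelfAdjoint.one (H₁ →L[ℂ] H₁)).adjoint_eq

theorem qform_opTensor_eq_enorm {A : H₁ →L[ℂ] H₁} {B : H₂ →L[ℂ] H₂} (hA : A.IsPositive)
    (hB : B.IsPositive) (φ : HTensor H₁ H₂) :
    qform (opTensor A B) φ = ‖opTensor (CFC.sqrt A) (CFC.sqrt B) φ‖ₑ ^ 2 := by
  rw [← opTensor_eq_sqrt_comp_adjoint hA hB, qform_comp_adjoint_self, adjoint_opTensor,
    adjoint_sqrt, adjoint_sqrt]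

/-- The quadratic form of `A ⊗ B` as a sum of quadratic forms of `B`. -/
theorem qform_opTensor_right {ι : Type*} (b : HilbertBasis ι ℂ H₁) {A : H₁ →L[ℂ] H₁}
    {B : H₂ →L[ℂ] H₂} (hA : A.IsPositive) (hB : B.IsPositive) (φ : HTensor H₁ H₂) :
    qform (opTensor A B) φ =
      ∑' i, qform B (adjoint (tensorLeft (b i)) (opTensor (CFC.sqrt A) 1 φ)) := by
  have h : opTensor (CFC.sqrt A) (CFC.sqrt B) =
      opTensor 1 (CFC.sqrt B) ∘L opTensor (CFC.sqrt A) (1 : H₂ →L[ℂ] H₂) := by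
    rw [opTensor_comp]
    rfl
  -- Parseval in the product basis; for fixed `i`, the coordinates over `j` form the squared norm of
  -- `√B` applied to one slice. The slices do not depend on `B`, so `B` can be integrated inside the
  -- sum.
  rw [qform_opTensor_eq_enorm hA hB, h, comp_apply,
    ← tsum_enorm_inner_sq (prodBasis b (onb H₂)),
    ENNReal.tsum_prod (f := fun i j => ‖⟪prodBasis b (onb H₂) (i, j), _⟫_ℂ‖ₑ ^ 2)]
  congr with i
  rw [qform_eq_enorm_sqrt hB, ← tsum_enorm_inner_sq (onb H₂)]
  congr with j
  rw [prodBasis_apply, ← adjoint_inner_left, adjoint_opTensor, opTensor_htmul, adjoint_one,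
    ← adjoint_inner_left (CFC.sqrt B), adjoint_inner_right, tensorLeft_apply]
  rfl

/-- The quadratic form of `A ⊗ B` as a sum of quadratic forms of `A`. -/
theorem qform_opTensor_left {κ : Type*} (c : HilbertBasis κ ℂ H₂) {A : H₁ →L[ℂ] H₁}
    {B : H₂ →L[ℂ] H₂} (hA : A.IsPositive) (hB : B.IsPositive) (φ : HTensor H₁ H₂) :
    qform (opTensor A B) φ =
      ∑' j, qform A (adjoint (tensorRight (c j)) (opTensor 1 (CFC.sqrt B) φ)) := by
  have h : opTensor (CFC.sqrt A) (CFC.sqrt B) =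
      opTensor (CFC.sqrt A) 1 ∘L opTensor (1 : H₁ →L[ℂ] H₁) (CFC.sqrt B) := by
    rw [opTensor_comp]
    rfl
  rw [qform_opTensor_eq_enorm hA hB, h, comp_apply,
    ← tsum_enorm_inner_sq (prodBasis (onb H₁) c),
    ENNReal.tsum_prod (f := fun i j => ‖⟪prodBasis (onb H₁) c (i, j), _⟫_ℂ‖ₑ ^ 2),
    ENNReal.tsum_comm]
  congr with j
  rw [qform_eq_enorm_sqrt hA, ← tsum_enorm_inner_sq (onb H₁)]
  congr with i
  rw [prodBasis_apply, ← adjoint_inner_left, adjoint_opTensor, opTensor_htmul, adjoint_one,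
    ← adjoint_inner_left (CFC.sqrt A), adjoint_inner_right, tensorRight_apply]
  rfl

theorem trPair_opTensor {ι κ : Type*} (b : HilbertBasis ι ℂ H₁) (c : HilbertBasis κ ℂ H₂)
    {T : HTensor H₁ H₂ →L[ℂ] HTensor H₁ H₂} (hT : T.IsPositive) {A : H₁ →L[ℂ] H₁}
    {B : H₂ →L[ℂ] H₂} (hA : A.IsPositive) (hB : B.IsPositive) :
    trPair T (opTensor A B) =
      ∑' (i) (j), qform T (htmul (CFC.sqrt A (b i)) (CFC.sqrt B (c j))) := by
  rw [← opTensor_eq_sqrt_comp_adjoint hA hB, trPair_comp_adjoint (prodBasis b c) hT,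
    ENNReal.tsum_prod (f := fun i j => qform T (opTensor (CFC.sqrt A) (CFC.sqrt B)
      (prodBasis b c (i, j))))]
  simp_rw [prodBasis_apply, opTensor_htmul]

theorem trPair_opTensor_opTensor {S A : H₁ →L[ℂ] H₁} {T B : H₂ →L[ℂ] H₂} (hS : S.IsPositive)
    (hT : T.IsPositive) (hA : A.IsPositive) (hB : B.IsPositive) :
    trPair (opTensor S T) (opTensor A B) = trPair S A * trPair T B := by
  rw [trPair_opTensor (onb H₁) (onb H₂) (isPositive_opTensor hS hT) hA hB,
    trPair_eq (onb H₁) hS hA, trPair_eq (onb H₂) hT hB]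
  simp_rw [qform_opTensor_htmul hS hT, ENNReal.tsum_mul_left, ENNReal.tsum_mul_right]

theorem trPos_opTensor {S : H₁ →L[ℂ] H₁} {T : H₂ →L[ℂ] H₂} (hS : S.IsPositive)
    (hT : T.IsPositive) : trPos (opTensor S T) = trPos S * trPos T := by
  rw [← trPair_one (isPositive_opTensor hS hT), ← opTensor_one_one,
    trPair_opTensor_opTensor hS hT isPositive_one isPositive_one, trPair_one hS, trPair_one hT]

theorem IsState.opTensor {S : H₁ →L[ℂ] H₁} {T : H₂ →L[ℂ] H₂} (hS : IsState S)
    (hT : IsState T) : IsState (opTensor S T) := by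
  rw [isState_iff] at hS hT ⊢
  exact ⟨isPositive_opTensor hS.1 hT.1, by rw [trPos_opTensor hS.1 hT.1, hS.2, hT.2, mul_one]⟩

theorem MeasurableField.opTensor {Z : Type*} [MeasurableSpace Z]
    [TopologicalSpace.SeparableSpace H₁] [TopologicalSpace.SeparableSpace H₂]
    {S : Z → H₁ →L[ℂ] H₁} {T : Z → H₂ →L[ℂ] H₂} (hS : MeasurableField S)
    (hT : MeasurableField T) : MeasurableField fun z => MeasChannel.opTensor (S z) (T z) := by
  refine measurableField_of_basis (prodBasis (onb H₁) (onb H₂)) fun i j => ?_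
  simp_rw [prodBasis_apply, opTensor_htmul, inner_htmul]
  exact (hS _ _).mul (hT _ _)

/-- By the slice formulas for `A ⊗ B`, integrating over `y₂` replaces `m₂` by the identity;
integrating over `y₁` then does the same for `m₁`. -/
theorem IsPOVMDensity.prod [TopologicalSpace.SeparableSpace H₁]
    [TopologicalSpace.SeparableSpace H₂] {Y₁ Y₂ : Type*} [MeasurableSpace Y₁] [MeasurableSpace Y₂]
    {μ₁ : Measure Y₁} {μ₂ : Measure Y₂} [SFinite μ₁] [SFinite μ₂] {m₁ : Y₁ → H₁ →L[ℂ] H₁}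
    {m₂ : Y₂ → H₂ →L[ℂ] H₂} {b₁ b₂ : ℝ} (h₁ : IsPOVMDensity μ₁ m₁ b₁)
    (h₂ : IsPOVMDensity μ₂ m₂ b₂) :
    IsPOVMDensity (μ₁.prod μ₂) (prodDensity m₁ m₂) (b₁ * b₂) := by
  have hmeas : MeasurableField (prodDensity m₁ m₂) :=
    (MeasurableField.comp h₁.measurable measurable_fst).opTensor
      (MeasurableField.comp h₂.measurable measurable_snd)
  refine ⟨hmeas, fun y => isPositive_opTensor (h₁.isPositive _) (h₂.isPositive _), fun y => ?_,
    fun φ => ?_⟩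
  · exact (norm_opTensor_le _ _).trans (mul_le_mul (h₁.norm_le _) (h₂.norm_le _) (norm_nonneg _)
      ((norm_nonneg _).trans (h₁.norm_le y.1)))
  · have hr : ∀ y₁, ∫⁻ y₂, qform (opTensor (m₁ y₁) (m₂ y₂)) φ ∂μ₂ =
        qform (opTensor (m₁ y₁) 1) φ := fun y₁ => by
      simp_rw [fun y₂ => qform_opTensor_right (onb H₁) (h₁.isPositive y₁) (h₂.isPositive y₂) φ]
      rw [lintegral_tsum fun i =>
        (MeasurableField.measurable_qform h₂.measurable _).aemeasurable]
      simp_rw [h₂.lintegral_qform]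
      rw [qform_opTensor_right (onb H₁) (h₁.isPositive y₁) isPositive_one]
      simp_rw [qform_one]
    have hl : ∫⁻ y₁, qform (opTensor (m₁ y₁) (1 : H₂ →L[ℂ] H₂)) φ ∂μ₁ = ‖φ‖ₑ ^ 2 := by
      simp_rw [fun y₁ => qform_opTensor_left (onb H₂) (h₁.isPositive y₁)
        (isPositive_one (𝕜 := ℂ) (E := H₂)) φ]
      rw [lintegral_tsum fun i =>
        (MeasurableField.measurable_qform h₁.measurable _).aemeasurable]
      simp_rw [h₁.lintegral_qform]
      rw [← qform_one φ, ← opTensor_one_one, qform_opTensor_left (onb H₂) isPositive_one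
        isPositive_one]
      simp_rw [qform_one]
    change ∫⁻ y, qform (prodDensity m₁ m₂ y) φ ∂(μ₁.prod μ₂) = _
    rw [lintegral_prod _ (hmeas.measurable_qform φ).aemeasurable]
    simp only [prodDensity]
    simp_rw [hr]
    rw [hl, ENNReal.ofReal_pow (norm_nonneg _), ofReal_norm]

end TensorOperators

/-! ### Partial traces and posterior operators -/

section PartialTrace

open ContinuousLinearMap

set_option linter.unusedSectionVars false

variable {H : Type*} [NormedAddCommGroup H] [InnerProductSpace ℂ H] [CompleteSpace H]

/-- Convergence is absolute in operator norm, because the norm of a positive operator is at most its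
trace. Thus the `tsum`s defining partial traces and posteriors are genuine sums, not the default
value `0`. -/
theorem hasSum_of_trPos {ι : Type*} {A : ι → H →L[ℂ] H} (hA : ∀ i, (A i).IsPositive)
    (h : ∑' i, trPos (A i) ≠ ∞) : HasSum A (∑' i, A i) := by
  refine Summable.hasSum (Summable.of_norm ?_)
  refine Summable.of_nonneg_of_le (fun i => norm_nonneg _) (fun i => ?_) (ENNReal.summable_toReal h)
  rw [← ENNReal.ofReal_le_iff_le_toReal (ENNReal.ne_top_of_tsum_ne_top h i), ofReal_norm]
  exact norm_le_trPos (hA i)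

theorem hasSum_inner_of_trPos {ι : Type*} {A : ι → H →L[ℂ] H} (hA : ∀ i, (A i).IsPositive)
    (h : ∑' i, trPos (A i) ≠ ∞) (φ ψ : H) :
    HasSum (fun i => ⟪φ, A i ψ⟫_ℂ) ⟪φ, (∑' i, A i) ψ⟫_ℂ := by
  have hc : Continuous fun T : H →L[ℂ] H => ⟪φ, T ψ⟫_ℂ := by fun_prop
  exact (hasSum_of_trPos hA h).map
    (AddMonoidHom.mk' (fun T : H →L[ℂ] H => ⟪φ, T ψ⟫_ℂ) fun T S => by simp) hc

theorem qform_tsum {ι : Type*} {A : ι → H →L[ℂ] H} (hA : ∀ i, (A i).IsPositive)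
    (h : ∑' i, trPos (A i) ≠ ∞) (φ : H) : qform (∑' i, A i) φ = ∑' i, qform (A i) φ := by
  have h1 := Complex.hasSum_re (hasSum_inner_of_trPos hA h φ φ)
  rw [qform, ← h1.tsum_eq, ENNReal.ofReal_tsum_of_nonneg (fun i => re_inner_nonneg (hA i) φ)
    h1.summable]
  rfl

theorem isPositive_tsum {ι : Type*} {A : ι → H →L[ℂ] H} (hA : ∀ i, (A i).IsPositive)
    (h : ∑' i, trPos (A i) ≠ ∞) : (∑' i, A i).IsPositive := by
  rw [isPositive_def']
  constructor
  · rw [isSelfAdjoint_iff, ← (hasSum_of_trPos hA h).star.tsum_eq]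
    congr with i
    rw [(hA i).isSelfAdjoint.star_eq]
  · intro φ
    have h1 := Complex.hasSum_re (hasSum_inner_of_trPos hA h φ φ)
    have h2 := h1.nonneg fun i => re_inner_nonneg (hA i) φ
    rw [reApplyInnerSelf_apply, inner_re_symm]
    exact h2

theorem eq_of_qform {S T : H →L[ℂ] H} (hS : S.IsPositive) (hT : T.IsPositive)
    (h : ∀ φ, qform S φ = qform T φ) : S = T := by
  refine (ContinuousLinearMap.coe_inj (R₁ := ℂ)).1 ((ext_inner_map _ _).1 fun φ => ?_)
  change ⟪S φ, φ⟫_ℂ = ⟪T φ, φ⟫_ℂ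
  rw [hS.inner_left_eq_inner_right, hT.inner_left_eq_inner_right, ← ofReal_qform hS,
    ← ofReal_qform hT, h]

theorem qform_le_trPos {T : H →L[ℂ] H} (hT : T.IsPositive) (φ : H) :
    qform T φ ≤ trPos T * ‖φ‖ₑ ^ 2 := by
  refine (qform_le le_rfl φ).trans ?_
  rw [ofReal_norm]
  gcongr
  exact norm_le_trPos hT

theorem trPair_smul {c : ℝ} (hc : 0 ≤ c) {T m : H →L[ℂ] H} (hT : T.IsPositive)
    (hm : m.IsPositive) : trPair (c • T) m = ENNReal.ofReal c * trPair T m := by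
  rw [trPair_eq (onb H) (isPositive_real_smul hT hc) hm, trPair_eq (onb H) hT hm]
  simp_rw [qform_smul hc, ENNReal.tsum_mul_left]

theorem trPos_smul {c : ℝ} (hc : 0 ≤ c) (T : H →L[ℂ] H) :
    trPos (c • T) = ENNReal.ofReal c * trPos T := by
  simp_rw [trPos, qform_smul hc, ENNReal.tsum_mul_left]

variable {H₁ H₂ : Type*}
  [NormedAddCommGroup H₁] [InnerProductSpace ℂ H₁] [CompleteSpace H₁]
  [NormedAddCommGroup H₂] [InnerProductSpace ℂ H₂] [CompleteSpace H₂]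
  {T : HTensor H₁ H₂ →L[ℂ] HTensor H₁ H₂}

theorem isPositive_slice {K : Type*} [NormedAddCommGroup K] [InnerProductSpace ℂ K]
    [CompleteSpace K] (hT : T.IsPositive) (A : K →L[ℂ] HTensor H₁ H₂) :
    (adjoint A ∘L T ∘L A).IsPositive := hT.adjoint_conj A

theorem tsum_trPos_slice_snd (hT : T.IsPositive) :
    ∑' j, trPos (adjoint (tensorRight (onb H₂ j)) ∘L T ∘L tensorRight (onb H₂ j) :
      H₁ →L[ℂ] H₁) = trPos T := by
  rw [trPos_eq (prodBasis (onb H₁) (onb H₂)) hT,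
    ENNReal.tsum_prod (f := fun i j => qform T (prodBasis (onb H₁) (onb H₂) (i, j))),
    ENNReal.tsum_comm]
  simp_rw [trPos, qform_adjoint_conj, prodBasis_apply, tensorRight_apply]

theorem isPositive_partialTraceSnd (hT : T.IsPositive) (htr : trPos T ≠ ∞) :
    (partialTraceSnd T).IsPositive :=
  isPositive_tsum (fun _ => isPositive_slice hT _) (by rwa [tsum_trPos_slice_snd hT])

theorem qform_partialTraceSnd (hT : T.IsPositive) (htr : trPos T ≠ ∞) (φ : H₁) :
    qform (partialTraceSnd T) φ = ∑' j, qform T (htmul φ (onb H₂ j)) := by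
  rw [partialTraceSnd, qform_tsum (fun _ => isPositive_slice hT _)
    (by rwa [tsum_trPos_slice_snd hT])]
  simp_rw [qform_adjoint_conj, tensorRight_apply]

theorem tsum_trPos_slice_fst (hT : T.IsPositive) {m : H₁ →L[ℂ] H₁} (hm : m.IsPositive) :
    ∑' i, trPos (adjoint (tensorLeft (CFC.sqrt m (onb H₁ i))) ∘L T ∘L
      tensorLeft (CFC.sqrt m (onb H₁ i)) : H₂ →L[ℂ] H₂) = trPair T (opTensor m 1) := by
  have h : opTensor m (1 : H₂ →L[ℂ] H₂) =
      opTensor (CFC.sqrt m) 1 ∘L adjoint (opTensor (CFC.sqrt m) (1 : H₂ →L[ℂ] H₂)) := by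
    rw [adjoint_opTensor, opTensor_comp, sqrt_comp_adjoint_sqrt hm, adjoint_one]
    rfl
  rw [h, trPair_comp_adjoint (prodBasis (onb H₁) (onb H₂)) hT,
    ENNReal.tsum_prod (f := fun i j => qform T (opTensor (CFC.sqrt m) 1
      (prodBasis (onb H₁) (onb H₂) (i, j))))]
  simp_rw [trPos, qform_adjoint_conj, prodBasis_apply, opTensor_htmul, tensorLeft_apply]
  rfl

/-- The unnormalized posterior operator `Tr₁ T (m ⊗ I)` on the second factor. -/
def posterior (T : HTensor H₁ H₂ →L[ℂ] HTensor H₁ H₂) (m : H₁ →L[ℂ] H₁) : H₂ →L[ℂ] H₂ :=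
  ∑' i, adjoint (tensorLeft (CFC.sqrt m (onb H₁ i))) ∘L T ∘L tensorLeft (CFC.sqrt m (onb H₁ i))

variable {m : H₁ →L[ℂ] H₁}

theorem isPositive_posterior (hT : T.IsPositive) (htr : trPos T ≠ ∞) (hm : m.IsPositive) :
    (posterior T m).IsPositive :=
  isPositive_tsum (fun _ => isPositive_slice hT _)
    (by rw [tsum_trPos_slice_fst hT hm]; exact trPair_ne_top hT htr)

theorem qform_posterior (hT : T.IsPositive) (htr : trPos T ≠ ∞) (hm : m.IsPositive) (φ : H₂) :
    qform (posterior T m) φ = ∑' i, qform T (htmul (CFC.sqrt m (onb H₁ i)) φ) := by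
  rw [posterior, qform_tsum (fun _ => isPositive_slice hT _)
    (by rw [tsum_trPos_slice_fst hT hm]; exact trPair_ne_top hT htr)]
  simp_rw [qform_adjoint_conj, tensorLeft_apply]

/-- Removes `√m` in favour of an expression linear in `m`: joint measurability then follows from
`measurable_trPair`, and integration over outcomes from `lintegral_trPair_conj`. -/
theorem qform_posterior_eq_trPair (hT : T.IsPositive) (htr : trPos T ≠ ∞) (hm : m.IsPositive)
    (φ : H₂) : qform (posterior T m) φ =
      trPair T (tensorRight φ ∘L m ∘L adjoint (tensorRight φ)) := by
  have h : tensorRight φ ∘L m ∘L adjoint (tensorRight φ) =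
      (tensorRight φ ∘L CFC.sqrt m) ∘L adjoint (tensorRight φ ∘L CFC.sqrt m) := by
    rw [adjoint_comp, comp_assoc, ← comp_assoc (CFC.sqrt m), sqrt_comp_adjoint_sqrt hm]
  rw [h, trPair_comp_adjoint (onb H₁) hT, qform_posterior hT htr hm]
  rfl

theorem trPair_posterior (hT : T.IsPositive) (htr : trPos T ≠ ∞) (hm : m.IsPositive)
    {n : H₂ →L[ℂ] H₂} (hn : n.IsPositive) :
    trPair (posterior T m) n = trPair T (opTensor m n) := by
  rw [trPair_eq (onb H₂) (isPositive_posterior hT htr hm) hn,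
    trPair_opTensor (onb H₁) (onb H₂) hT hm hn, ENNReal.tsum_comm]
  simp_rw [qform_posterior hT htr hm]

/-- The normalizing constant of the posterior is the density of the first outcome in the partial
state. -/
theorem trPos_posterior (hT : T.IsPositive) (htr : trPos T ≠ ∞) (hm : m.IsPositive) :
    trPos (posterior T m) = trPair (partialTraceSnd T) m := by
  rw [trPos, trPair_eq (onb H₁) (isPositive_partialTraceSnd hT htr) hm]
  simp_rw [qform_posterior hT htr hm, qform_partialTraceSnd hT htr]
  rw [ENNReal.tsum_comm]

theorem trPos_partialTraceSnd (hT : T.IsPositive) (htr : trPos T ≠ ∞) :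
    trPos (partialTraceSnd T) = trPos T := by
  rw [trPos_eq (prodBasis (onb H₁) (onb H₂)) hT,
    ENNReal.tsum_prod (f := fun i j => qform T (prodBasis (onb H₁) (onb H₂) (i, j)))]
  simp_rw [trPos, qform_partialTraceSnd hT htr, prodBasis_apply]

theorem IsState.partialTraceSnd (hT : IsState T) : IsState (partialTraceSnd T) :=
  isState_iff.2 ⟨isPositive_partialTraceSnd hT.isPositive hT.trPos_ne_top, by
    rw [trPos_partialTraceSnd hT.isPositive hT.trPos_ne_top, (isState_iff.1 hT).2]⟩

theorem tsum_trPos_slice_fst_one (hT : T.IsPositive) :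
    ∑' i, trPos (adjoint (tensorLeft (onb H₁ i)) ∘L T ∘L tensorLeft (onb H₁ i) :
      H₂ →L[ℂ] H₂) = trPos T := by
  rw [trPos_eq (prodBasis (onb H₁) (onb H₂)) hT,
    ENNReal.tsum_prod (f := fun i j => qform T (prodBasis (onb H₁) (onb H₂) (i, j)))]
  simp_rw [trPos, qform_adjoint_conj, prodBasis_apply, tensorLeft_apply]

theorem isPositive_partialTraceFst (hT : T.IsPositive) (htr : trPos T ≠ ∞) :
    (partialTraceFst T).IsPositive :=
  isPositive_tsum (fun _ => isPositive_slice hT _) (by rwa [tsum_trPos_slice_fst_one hT])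

theorem qform_partialTraceFst (hT : T.IsPositive) (htr : trPos T ≠ ∞) (φ : H₂) :
    qform (partialTraceFst T) φ = ∑' i, qform T (htmul (onb H₁ i) φ) := by
  rw [partialTraceFst, qform_tsum (fun _ => isPositive_slice hT _)
    (by rwa [tsum_trPos_slice_fst_one hT])]
  simp_rw [qform_adjoint_conj, tensorLeft_apply]

theorem qform_partialTraceFst_eq_trPair (hT : T.IsPositive) (htr : trPos T ≠ ∞) (φ : H₂) :
    qform (partialTraceFst T) φ = trPair T (tensorRight φ ∘L adjoint (tensorRight φ)) := by
  rw [trPair_comp_adjoint (onb H₁) hT, qform_partialTraceFst hT htr]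
  rfl

theorem partialTraceSnd_opTensor {S : H₁ →L[ℂ] H₁} {R : H₂ →L[ℂ] H₂} (hS : IsState S)
    (hR : IsState R) : partialTraceSnd (opTensor S R) = S := by
  have h := hS.opTensor hR
  refine eq_of_qform (isPositive_partialTraceSnd h.isPositive h.trPos_ne_top) hS.isPositive
    fun φ => ?_
  rw [qform_partialTraceSnd h.isPositive h.trPos_ne_top]
  simp_rw [qform_opTensor_htmul hS.isPositive hR.isPositive]
  rw [ENNReal.tsum_mul_left, ← trPos, (isState_iff.1 hR).2, mul_one]

theorem partialTraceFst_opTensor {S : H₁ →L[ℂ] H₁} {R : H₂ →L[ℂ] H₂} (hS : IsState S)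
    (hR : IsState R) : partialTraceFst (opTensor S R) = R := by
  have h := hS.opTensor hR
  refine eq_of_qform (isPositive_partialTraceFst h.isPositive h.trPos_ne_top) hR.isPositive
    fun φ => ?_
  rw [qform_partialTraceFst h.isPositive h.trPos_ne_top]
  simp_rw [qform_opTensor_htmul hS.isPositive hR.isPositive]
  rw [ENNReal.tsum_mul_right, ← trPos, (isState_iff.1 hS).2, one_mul]

end PartialTrace

/-! ### Chain rule and superadditivity -/

section Superadditivity

open ContinuousLinearMap

set_option linter.unusedSectionVars false

variable {H₁ H₂ Y₁ Y₂ : Type*}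
  [NormedAddCommGroup H₁] [InnerProductSpace ℂ H₁] [CompleteSpace H₁]
  [TopologicalSpace.SeparableSpace H₁]
  [NormedAddCommGroup H₂] [InnerProductSpace ℂ H₂] [CompleteSpace H₂]
  [TopologicalSpace.SeparableSpace H₂]
  [MeasurableSpace Y₁] [MeasurableSpace Y₂]
  {μ₁ : Measure Y₁} {μ₂ : Measure Y₂} [SFinite μ₁] [SFinite μ₂]
  {m₁ : Y₁ → H₁ →L[ℂ] H₁} {m₂ : Y₂ → H₂ →L[ℂ] H₂} {b₁ b₂ : ℝ}

/-- The normalized posterior state; it is `0` where the outcome density vanishes. -/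
def posteriorState (T : HTensor H₁ H₂ →L[ℂ] HTensor H₁ H₂) (m : H₁ →L[ℂ] H₁) : H₂ →L[ℂ] H₂ :=
  (trPos (posterior T m)).toReal⁻¹ • posterior T m

section

variable {T : HTensor H₁ H₂ →L[ℂ] HTensor H₁ H₂} {m : H₁ →L[ℂ] H₁}

theorem trPos_posterior_ne_top (hT : IsState T) (hm : m.IsPositive) :
    trPos (posterior T m) ≠ ∞ := by
  rw [trPos_posterior hT.isPositive hT.trPos_ne_top hm]
  exact trPair_ne_top hT.partialTraceSnd.isPositive hT.partialTraceSnd.trPos_ne_top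

theorem isPositive_posteriorState (hT : IsState T) (hm : m.IsPositive) :
    (posteriorState T m).IsPositive :=
  isPositive_real_smul (isPositive_posterior hT.isPositive hT.trPos_ne_top hm) (by positivity)

theorem ofReal_inv_mul_self {p : ℝ≥0∞} (h0 : p ≠ 0) (ht : p ≠ ∞) :
    ENNReal.ofReal p.toReal⁻¹ * p = 1 := by
  rw [ENNReal.ofReal_inv_of_pos (ENNReal.toReal_pos h0 ht), ENNReal.ofReal_toReal ht,
    ENNReal.inv_mul_cancel h0 ht]

theorem trPos_posteriorState (hT : IsState T) (hm : m.IsPositive)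
    (h0 : trPos (posterior T m) ≠ 0) : trPos (posteriorState T m) = 1 := by
  rw [posteriorState, trPos_smul (by positivity),
    ofReal_inv_mul_self h0 (trPos_posterior_ne_top hT hm)]

theorem trPos_posteriorState_ne_top (hT : IsState T) (hm : m.IsPositive) :
    trPos (posteriorState T m) ≠ ∞ := by
  rw [posteriorState, trPos_smul (by positivity)]
  exact ENNReal.mul_ne_top ENNReal.ofReal_ne_top (trPos_posterior_ne_top hT hm)

/-- True also where the density vanishes, since a positive operator of trace zero has zero quadratic
form. -/
theorem trPos_mul_qform_posteriorState (hT : IsState T) (hm : m.IsPositive) (φ : H₂) :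
    trPos (posterior T m) * qform (posteriorState T m) φ = qform (posterior T m) φ := by
  rw [posteriorState, qform_smul (by positivity), ← mul_assoc]
  by_cases h0 : trPos (posterior T m) = 0
  · have h := qform_le_trPos (isPositive_posterior hT.isPositive hT.trPos_ne_top hm) φ
    rw [h0, zero_mul, nonpos_iff_eq_zero] at h
    simp [h]
  · rw [mul_comm (trPos _), ofReal_inv_mul_self h0 (trPos_posterior_ne_top hT hm), one_mul]

end

/-- The chain rule for one first outcome: the joint density is `p r`, with `p` the marginal and `r`
the density in the posterior state. Apply `entFun_mul` and use `∫ r = 1`; for `p = 0` every term is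
zero. -/
theorem IsPOVMDensity.lintegral_entFun_posterior (hb₁ : 1 ≤ b₁) (hb₂ : 1 ≤ b₂)
    (h₂ : IsPOVMDensity μ₂ m₂ b₂) {T : HTensor H₁ H₂ →L[ℂ] HTensor H₁ H₂} (hT : IsState T)
    {m : H₁ →L[ℂ] H₁} (hm : m.IsPositive) (hmb : ‖m‖ ≤ b₁) :
    ∫⁻ y, ENNReal.ofReal (entFun (b₁ * b₂) (trPair T (opTensor m (m₂ y))).toReal) ∂μ₂ =
      ENNReal.ofReal (entFun b₁ (trPair (partialTraceSnd T) m).toReal) +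
        trPos (posterior T m) * shiftedEntropy μ₂ m₂ b₂ (posteriorState T m) := by
  have hpos := isPositive_posterior hT.isPositive hT.trPos_ne_top hm
  have hfin := trPos_posterior_ne_top hT hm
  simp_rw [← fun y => trPair_posterior hT.isPositive hT.trPos_ne_top hm (h₂.isPositive y)]
  have hple : (trPair (partialTraceSnd T) m).toReal ≤ b₁ := by
    have h := trPair_le hT.partialTraceSnd.isPositive hmb
    rw [(isState_iff.1 hT.partialTraceSnd).2, mul_one] at h
    exact ENNReal.toReal_le_of_le_ofReal (by linarith) h
  rw [← trPos_posterior hT.isPositive hT.trPos_ne_top hm] at hple ⊢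
  by_cases h0 : trPos (posterior T m) = 0
  · have hz : ∀ y, trPair (posterior T m) (m₂ y) = 0 := fun y => by
      have := trPair_le hpos (h₂.norm_le y)
      rwa [h0, mul_zero, nonpos_iff_eq_zero] at this
    simp [hz, h0, entFun]
  have hR : IsState (posteriorState T m) :=
    isState_iff.2 ⟨isPositive_posteriorState hT hm, trPos_posteriorState hT hm h0⟩
  have hq : ∀ y, (trPair (posterior T m) (m₂ y)).toReal =
      (trPos (posterior T m)).toReal * (trPair (posteriorState T m) (m₂ y)).toReal := fun y => by
    rw [posteriorState, trPair_smul (by positivity) hpos (h₂.isPositive y), ENNReal.toReal_mul,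
      ENNReal.toReal_ofReal (by positivity),
      mul_inv_cancel_left₀ (ENNReal.toReal_pos h0 hfin).ne']
  have hqm : Measurable fun y => trPair (posteriorState T m) (m₂ y) :=
    measurable_trPair (T := fun _ => posteriorState T m) (fun φ ψ => measurable_const)
      h₂.measurable (fun _ => hR.isPositive) h₂.isPositive fun _ => hR.trPos_ne_top
  have hqt : ∀ y, trPair (posteriorState T m) (m₂ y) ≠ ∞ := fun y =>
    trPair_ne_top hR.isPositive hR.trPos_ne_top
  simp_rw [hq, entFun_mul (show 0 < b₁ by linarith) (show 0 < b₂ by linarith)]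
  have he₁ := entFun_nonneg ENNReal.toReal_nonneg hple
  have hsplit : ∀ y, ENNReal.ofReal ((trPair (posteriorState T m) (m₂ y)).toReal *
      entFun b₁ (trPos (posterior T m)).toReal + (trPos (posterior T m)).toReal *
      entFun b₂ (trPair (posteriorState T m) (m₂ y)).toReal) =
      trPair (posteriorState T m) (m₂ y) *
        ENNReal.ofReal (entFun b₁ (trPos (posterior T m)).toReal) +
      trPos (posterior T m) *
        ENNReal.ofReal (entFun b₂ (trPair (posteriorState T m) (m₂ y)).toReal) := fun y => by
    rw [ENNReal.ofReal_add (mul_nonneg ENNReal.toReal_nonneg he₁)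
      (mul_nonneg ENNReal.toReal_nonneg
        (entFun_nonneg ENNReal.toReal_nonneg (h₂.trPair_toReal_le hR y))),
      ENNReal.ofReal_mul ENNReal.toReal_nonneg, ENNReal.ofReal_mul ENNReal.toReal_nonneg,
      ENNReal.ofReal_toReal hfin, ENNReal.ofReal_toReal (hqt y)]
  simp_rw [hsplit]
  rw [lintegral_add_left (hqm.mul_const _), lintegral_mul_const _ hqm,
    h₂.lintegral_trPair hR.isPositive, (isState_iff.1 hR).2, one_mul,
    lintegral_const_mul' _ _ hfin, shiftedEntropy]

theorem IsPOVMDensity.measurable_entFun_state (h₁ : IsPOVMDensity μ₁ m₁ b₁) {T : H₁ →L[ℂ] H₁}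
    (hT : IsState T) :
    Measurable fun y => ENNReal.ofReal (entFun b₁ (trPair T (m₁ y)).toReal) :=
  ((continuous_entFun b₁).measurable.comp (measurable_trPair (T := fun _ => T)
    (fun _ _ => measurable_const) h₁.measurable (fun _ => hT.isPositive) h₁.isPositive
    fun _ => hT.trPos_ne_top).ennreal_toReal).ennreal_ofReal

/-- Chain rule: the joint entropy is the entropy of the first outcome plus the mean entropy of the
second outcome in the posterior states. -/
theorem IsPOVMDensity.shiftedEntropy_prod (hb₁ : 1 ≤ b₁) (hb₂ : 1 ≤ b₂)
    (h₁ : IsPOVMDensity μ₁ m₁ b₁) (h₂ : IsPOVMDensity μ₂ m₂ b₂)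
    {T : HTensor H₁ H₂ →L[ℂ] HTensor H₁ H₂} (hT : IsState T) :
    shiftedEntropy (μ₁.prod μ₂) (prodDensity m₁ m₂) (b₁ * b₂) T =
      shiftedEntropy μ₁ m₁ b₁ (partialTraceSnd T) +
        ∫⁻ y, trPos (posterior T (m₁ y)) *
          shiftedEntropy μ₂ m₂ b₂ (posteriorState T (m₁ y)) ∂μ₁ := by
  rw [shiftedEntropy, lintegral_prod _ ((h₁.prod h₂).measurable_entFun_state hT).aemeasurable]
  simp only [prodDensity]
  simp_rw [fun y => h₂.lintegral_entFun_posterior hb₁ hb₂ hT (h₁.isPositive y) (h₁.norm_le y)]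
  rw [lintegral_add_left (h₁.measurable_entFun_state hT.partialTraceSnd)]
  rfl

/-- By the chain rule the cost of any ensemble for `ρ` splits into the cost of an ensemble for the
first partial state (partial traces) and of one for the second (posterior states indexed by `(x,
y)`). -/
theorem IsPOVMDensity.shiftedClosure_superadditive [StandardBorelSpace Y₁] (hb₁ : 1 ≤ b₁)
    (hb₂ : 1 ≤ b₂) (h₁ : IsPOVMDensity μ₁ m₁ b₁) (h₂ : IsPOVMDensity μ₂ m₂ b₂)
    {ρ : HTensor H₁ H₂ →L[ℂ] HTensor H₁ H₂} (hρ : IsState ρ) :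
    shiftedClosure μ₁ m₁ b₁ (partialTraceSnd ρ) + shiftedClosure μ₂ m₂ b₂ (partialTraceFst ρ) ≤
      shiftedClosure (μ₁.prod μ₂) (prodDensity m₁ m₂) (b₁ * b₂) ρ := by
  refine le_iInf ?_
  rintro ⟨E, hE⟩
  have hEm : MeasurableField E.ρ := E.measurable
  have hsndm : ∀ φ, Measurable fun x => qform (partialTraceSnd (E.ρ x)) φ := fun φ => by
    simp_rw [fun x => qform_partialTraceSnd (E.isState x).isPositive
      (E.isState x).trPos_ne_top φ]
    exact Measurable.tsum fun j => hEm.measurable_qform _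
  have hsnd : MeasurableField fun x => partialTraceSnd (E.ρ x) :=
    measurableField_of_qform (fun x => (E.isState x).partialTraceSnd.isPositive) hsndm
  have hle₁ : shiftedClosure μ₁ m₁ b₁ (partialTraceSnd ρ) ≤
      ∫⁻ x, shiftedEntropy μ₁ m₁ b₁ (partialTraceSnd (E.ρ x)) ∂E.π := by
    refine shiftedClosure_le_lintegral (fun x => (E.isState x).partialTraceSnd.isPositive) hsndm
      (.of_forall fun x => (isState_iff.1 (E.isState x).partialTraceSnd).2)
      hρ.partialTraceSnd.isPositive (fun φ => ?_) μ₁ m₁ b₁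
    simp_rw [fun x => qform_partialTraceSnd (E.isState x).isPositive
      (E.isState x).trPos_ne_top φ]
    rw [lintegral_tsum fun j => (hEm.measurable_qform _).aemeasurable,
      qform_partialTraceSnd hρ.isPositive hρ.trPos_ne_top]
    simp_rw [hE.lintegral_qform]
  let p : E.X × Y₁ → ℝ≥0∞ := fun z => trPos (posterior (E.ρ z.1) (m₁ z.2))
  have hp : Measurable p := by
    simp only [p]
    simp_rw [fun z : E.X × Y₁ => trPos_posterior (E.isState z.1).isPositive
      (E.isState z.1).trPos_ne_top (h₁.isPositive z.2)]
    exact measurable_trPair (hsnd.comp measurable_fst)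
      (MeasurableField.comp h₁.measurable measurable_snd)
      (fun z => (E.isState z.1).partialTraceSnd.isPositive) (fun z => h₁.isPositive z.2)
      fun z => (E.isState z.1).partialTraceSnd.trPos_ne_top
  have hqm : ∀ φ, Measurable fun z : E.X × Y₁ => qform (posterior (E.ρ z.1) (m₁ z.2)) φ := by
    intro φ
    simp_rw [fun z : E.X × Y₁ => qform_posterior_eq_trPair (E.isState z.1).isPositive
      (E.isState z.1).trPos_ne_top (h₁.isPositive z.2) φ]
    exact measurable_trPair (hEm.comp measurable_fst)
      (MeasurableField.comp (MeasurableField.conj_adjoint h₁.measurable (tensorRight φ))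
        measurable_snd) (fun z => (E.isState z.1).isPositive)
      (fun z => (h₁.isPositive z.2).conj_adjoint _) fun z => (E.isState z.1).trPos_ne_top
  let R : E.X × Y₁ → H₂ →L[ℂ] H₂ := fun z => posteriorState (E.ρ z.1) (m₁ z.2)
  have hRpos : ∀ z, (R z).IsPositive := fun z =>
    isPositive_posteriorState (E.isState z.1) (h₁.isPositive z.2)
  have hRq : ∀ φ, Measurable fun z => qform (R z) φ := fun φ => by
    have : (fun z => qform (R z) φ) = fun z => ENNReal.ofReal (p z).toReal⁻¹ *
        qform (posterior (E.ρ z.1) (m₁ z.2)) φ := by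
      ext z
      exact qform_smul (by positivity) _ _
    rw [this]
    exact hp.ennreal_toReal.inv.ennreal_ofReal.mul (hqm φ)
  have hSE : Measurable fun z => shiftedEntropy μ₂ m₂ b₂ (R z) :=
    h₂.measurable_shiftedEntropy (measurableField_of_qform hRpos hRq) hRpos
      fun z => trPos_posteriorState_ne_top (E.isState z.1) (h₁.isPositive z.2)
  -- The joint law of the ensemble index and the first outcome; its total mass is one because each
  -- output density integrates to one.
  let π := (E.π.prod μ₁).withDensity p
  have hintegral : ∀ u : E.X × Y₁ → ℝ≥0∞, Measurable u →
      ∫⁻ z, u z ∂π = ∫⁻ x, ∫⁻ y, p (x, y) * u (x, y) ∂μ₁ ∂E.π := fun u hu => by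
    rw [lintegral_withDensity_eq_lintegral_mul _ hp hu,
      lintegral_prod _ (hp.mul hu).aemeasurable]
    rfl
  have hπ : IsProbabilityMeasure π := by
    constructor
    have h := hintegral (fun _ => 1) measurable_const
    rw [lintegral_const, one_mul] at h
    rw [h]
    have h1 : ∀ x, ∫⁻ y, p (x, y) * 1 ∂μ₁ = 1 := fun x => by
      simp only [p, mul_one]
      simp_rw [fun y => trPos_posterior (E.isState x).isPositive
        (E.isState x).trPos_ne_top (h₁.isPositive y)]
      rw [h₁.lintegral_trPair (E.isState x).partialTraceSnd.isPositive,
        (isState_iff.1 (E.isState x).partialTraceSnd).2]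
    simp_rw [h1]
    simp
  have hle₂ : shiftedClosure μ₂ m₂ b₂ (partialTraceFst ρ) ≤
      ∫⁻ x, ∫⁻ y, trPos (posterior (E.ρ x) (m₁ y)) *
        shiftedEntropy μ₂ m₂ b₂ (posteriorState (E.ρ x) (m₁ y)) ∂μ₁ ∂E.π := by
    refine (shiftedClosure_le_lintegral (π := π) hRpos hRq ?_
      (isPositive_partialTraceFst hρ.isPositive hρ.trPos_ne_top) (fun φ => ?_) μ₂ m₂ b₂).trans_eq
      (hintegral _ hSE)
    -- Where `p` vanishes `R` is zero rather than a state, but this set is null for `π`.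
    · rw [ae_withDensity_iff hp]
      exact .of_forall fun z hz =>
        trPos_posteriorState (E.isState z.1) (h₁.isPositive z.2) hz
    -- The weight `p` cancels the normalization; integrating over `y` with `∫ m₁ = 1` leaves the
    -- partial trace over the first factor of `E.ρ x`, which averages to that of `ρ`.
    · rw [hintegral _ (hRq φ)]
      simp only [p, R]
      simp_rw [fun x y => trPos_mul_qform_posteriorState (E.isState x) (h₁.isPositive y) φ,
        fun x y => qform_posterior_eq_trPair (E.isState x).isPositive
          (E.isState x).trPos_ne_top (h₁.isPositive y) φ, h₁.lintegral_trPair_conj,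
        ← fun x => qform_partialTraceFst_eq_trPair (E.isState x).isPositive
          (E.isState x).trPos_ne_top φ,
        fun x => qform_partialTraceFst (E.isState x).isPositive (E.isState x).trPos_ne_top φ]
      rw [lintegral_tsum fun j => (hEm.measurable_qform _).aemeasurable,
        qform_partialTraceFst hρ.isPositive hρ.trPos_ne_top]
      simp_rw [hE.lintegral_qform]
  simp_rw [fun x => h₁.shiftedEntropy_prod hb₁ hb₂ h₂ (E.isState x)]
  rw [lintegral_add_left (h₁.measurable_shiftedEntropy hsnd
    (fun x => (E.isState x).partialTraceSnd.isPositive)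
    fun x => (E.isState x).partialTraceSnd.trPos_ne_top)]
  exact add_le_add hle₁ hle₂

/-! ### Additivity -/

/-- On `S ⊗ T` the posterior operator is `Tr (S m₁)` times `T`, so the posterior state is `T`
wherever the density is nonzero, and the conditional term of the chain rule is constant. -/
theorem IsPOVMDensity.shiftedEntropy_opTensor (hb₁ : 1 ≤ b₁) (hb₂ : 1 ≤ b₂)
    (h₁ : IsPOVMDensity μ₁ m₁ b₁) (h₂ : IsPOVMDensity μ₂ m₂ b₂)
    {S : H₁ →L[ℂ] H₁} {T : H₂ →L[ℂ] H₂} (hS : IsState S) (hT : IsState T) :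
    shiftedEntropy (μ₁.prod μ₂) (prodDensity m₁ m₂) (b₁ * b₂) (opTensor S T) =
      shiftedEntropy μ₁ m₁ b₁ S + shiftedEntropy μ₂ m₂ b₂ T := by
  rw [h₁.shiftedEntropy_prod hb₁ hb₂ h₂ (hS.opTensor hT), partialTraceSnd_opTensor hS hT]
  congr 1
  have hST := hS.opTensor hT
  have hpost : ∀ y, posterior (opTensor S T) (m₁ y) = (trPair S (m₁ y)).toReal • T := fun y => by
    refine eq_of_qform (isPositive_posterior hST.isPositive hST.trPos_ne_top (h₁.isPositive y))
      (isPositive_real_smul hT.isPositive ENNReal.toReal_nonneg) fun φ => ?_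
    rw [qform_posterior hST.isPositive hST.trPos_ne_top (h₁.isPositive y),
      qform_smul ENNReal.toReal_nonneg,
      ENNReal.ofReal_toReal (trPair_ne_top hS.isPositive hS.trPos_ne_top),
      trPair_eq (onb H₁) hS.isPositive (h₁.isPositive y)]
    simp_rw [qform_opTensor_htmul hS.isPositive hT.isPositive, ENNReal.tsum_mul_right]
  have hmeas : Measurable fun y => trPair S (m₁ y) :=
    measurable_trPair (T := fun _ => S) (fun φ ψ => measurable_const) h₁.measurable
      (fun _ => hS.isPositive) h₁.isPositive fun _ => hS.trPos_ne_top
  have hterm : ∀ y, trPos (posterior (opTensor S T) (m₁ y)) *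
      shiftedEntropy μ₂ m₂ b₂ (posteriorState (opTensor S T) (m₁ y)) =
      trPair S (m₁ y) * shiftedEntropy μ₂ m₂ b₂ T := fun y => by
    have htr : trPos (posterior (opTensor S T) (m₁ y)) = trPair S (m₁ y) := by
      rw [hpost, trPos_smul ENNReal.toReal_nonneg, (isState_iff.1 hT).2, mul_one,
        ENNReal.ofReal_toReal (trPair_ne_top hS.isPositive hS.trPos_ne_top)]
    by_cases h0 : trPair S (m₁ y) = 0
    · rw [htr, h0, zero_mul, zero_mul]
    · rw [posteriorState, htr, hpost, smul_smul, inv_mul_cancel₀, one_smul]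
      exact (ENNReal.toReal_pos h0 (trPair_ne_top hS.isPositive hS.trPos_ne_top)).ne'
  simp_rw [hterm]
  rw [lintegral_mul_const _ hmeas, h₁.lintegral_trPair hS.isPositive, (isState_iff.1 hS).2,
    one_mul]

theorem lintegral_qform_opTensor {X₁ X₂ : Type*} [MeasurableSpace X₁] [MeasurableSpace X₂]
    {π₁ : Measure X₁} {π₂ : Measure X₂} [SFinite π₁] [SFinite π₂] {S : X₁ → H₁ →L[ℂ] H₁}
    {T : X₂ → H₂ →L[ℂ] H₂} (hS : MeasurableField S) (hT : MeasurableField T)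
    (hSp : ∀ x, (S x).IsPositive) (hTp : ∀ x, (T x).IsPositive) {σ : H₁ →L[ℂ] H₁}
    {τ : H₂ →L[ℂ] H₂} (hσ : σ.IsPositive) (hτ : τ.IsPositive)
    (hSσ : ∀ φ, ∫⁻ x, qform (S x) φ ∂π₁ = qform σ φ)
    (hTτ : ∀ φ, ∫⁻ x, qform (T x) φ ∂π₂ = qform τ φ) (φ : HTensor H₁ H₂) :
    ∫⁻ z, qform (opTensor (S z.1) (T z.2)) φ ∂(π₁.prod π₂) = qform (opTensor σ τ) φ := by
  have hm : MeasurableField fun z : X₁ × X₂ => opTensor (S z.1) (T z.2) :=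
    (hS.comp measurable_fst).opTensor (hT.comp measurable_snd)
  rw [lintegral_prod _ (hm.measurable_qform φ).aemeasurable]
  have h : ∀ x, ∫⁻ x', qform (opTensor (S x) (T x')) φ ∂π₂ = qform (opTensor (S x) τ) φ := by
    intro x
    simp_rw [fun x' => qform_opTensor_right (onb H₁) (hSp x) (hTp x') φ]
    rw [lintegral_tsum fun i => (hT.measurable_qform _).aemeasurable]
    simp_rw [hTτ]
    rw [qform_opTensor_right (onb H₁) (hSp x) hτ]
  simp_rw [h, fun x => qform_opTensor_left (onb H₂) (hSp x) hτ φ]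
  rw [lintegral_tsum fun i => (hS.measurable_qform _).aemeasurable]
  simp_rw [hSσ]
  rw [qform_opTensor_left (onb H₂) hσ hτ]

/-- The states `E.ρ x ⊗ F.ρ x'` under the product law have average `σ ⊗ τ`, and their entropies add.
-/
theorem IsPOVMDensity.shiftedClosure_opTensor_le (hb₁ : 1 ≤ b₁) (hb₂ : 1 ≤ b₂)
    (h₁ : IsPOVMDensity μ₁ m₁ b₁) (h₂ : IsPOVMDensity μ₂ m₂ b₂)
    {σ : H₁ →L[ℂ] H₁} {τ : H₂ →L[ℂ] H₂} (hσ : IsState σ) (hτ : IsState τ) :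
    shiftedClosure (μ₁.prod μ₂) (prodDensity m₁ m₂) (b₁ * b₂) (opTensor σ τ) ≤
      shiftedClosure μ₁ m₁ b₁ σ + shiftedClosure μ₂ m₂ b₂ τ := by
  refine ENNReal.le_iInf_add_iInf ?_
  rintro ⟨E, hE⟩ ⟨F, hF⟩
  have hEm : MeasurableField E.ρ := E.measurable
  have hFm : MeasurableField F.ρ := F.measurable
  have hst : ∀ z : E.X × F.X, IsState (opTensor (E.ρ z.1) (F.ρ z.2)) := fun z =>
    (E.isState z.1).opTensor (F.isState z.2)
  have hm : MeasurableField fun z : E.X × F.X => opTensor (E.ρ z.1) (F.ρ z.2) :=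
    (hEm.comp measurable_fst).opTensor (hFm.comp measurable_snd)
  refine (shiftedClosure_le_lintegral (π := E.π.prod F.π)
    (ρ := fun z : E.X × F.X => opTensor (E.ρ z.1) (F.ρ z.2)) (fun z => (hst z).isPositive)
    (fun φ => hm.measurable_qform φ) (.of_forall fun z => (isState_iff.1 (hst z)).2)
    (hσ.opTensor hτ).isPositive (lintegral_qform_opTensor hEm hFm
      (fun x => (E.isState x).isPositive) (fun x => (F.isState x).isPositive) hσ.isPositive
      hτ.isPositive hE.lintegral_qform hF.lintegral_qform) _ _ _).trans_eq ?_
  have hE' : Measurable fun x => shiftedEntropy μ₁ m₁ b₁ (E.ρ x) :=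
    h₁.measurable_shiftedEntropy hEm (fun x => (E.isState x).isPositive)
      fun x => (E.isState x).trPos_ne_top
  have hF' : Measurable fun x => shiftedEntropy μ₂ m₂ b₂ (F.ρ x) :=
    h₂.measurable_shiftedEntropy hFm (fun x => (F.isState x).isPositive)
      fun x => (F.isState x).trPos_ne_top
  simp_rw [fun z : E.X × F.X =>
    h₁.shiftedEntropy_opTensor hb₁ hb₂ h₂ (E.isState z.1) (F.isState z.2)]
  have hE₁ : Measurable fun z : E.X × F.X => shiftedEntropy μ₁ m₁ b₁ (E.ρ z.1) :=
    hE'.comp measurable_fst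
  have hF₂ : Measurable fun z : E.X × F.X => shiftedEntropy μ₂ m₂ b₂ (F.ρ z.2) :=
    hF'.comp measurable_snd
  rw [lintegral_add_left hE₁, lintegral_prod _ hE₁.aemeasurable, lintegral_prod _ hF₂.aemeasurable]
  simp

end Superadditivity

/-! ### Assembly of the theorem in extended reals -/

theorem ereal_add_sub_add (x y : ℝ≥0∞) (c d : ℝ) :
    ((x + y : ℝ≥0∞) : EReal) - ((c + d : ℝ) : EReal) =
      ((x : EReal) - (c : EReal)) + ((y : EReal) - (d : EReal)) := by
  have hfin : ∀ (z : NNReal) (s : ℝ), (((z : ℝ≥0∞) : EReal) - (s : EReal)) =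
      (((z : ℝ) - s : ℝ) : EReal) := fun z s => by
    rw [EReal.coe_nnreal_eq_coe_real, EReal.coe_sub]
  induction x using ENNReal.recTopCoe with
  | top =>
    induction y using ENNReal.recTopCoe with
    | top => simp [-EReal.coe_add]
    | coe y => rw [hfin y, top_add, EReal.coe_ennreal_top, EReal.top_sub_coe, EReal.top_sub_coe,
        EReal.top_add_coe]
  | coe x =>
    induction y using ENNReal.recTopCoe with
    | top => rw [hfin x, add_top, EReal.coe_ennreal_top, EReal.top_sub_coe, EReal.top_sub_coe,
        EReal.coe_add_top]
    | coe y =>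
      rw [hfin, hfin, ← ENNReal.coe_add, hfin, ← EReal.coe_add, NNReal.coe_add]
      congr 1
      ring

end MeasChannel

end

theorem lemma1 {H₁ Y₁ : Type*}
    [NormedAddCommGroup H₁] [InnerProductSpace ℂ H₁] [CompleteSpace H₁]
    [TopologicalSpace.SeparableSpace H₁]
    [MeasurableSpace Y₁] [StandardBorelSpace Y₁]
    (μ₁ : MeasureTheory.Measure Y₁) [MeasureTheory.SigmaFinite μ₁]
    (m₁ : Y₁ → H₁ →L[ℂ] H₁) (b₁ : ℝ) (hm₁ : MeasChannel.IsPOVMDensity μ₁ m₁ b₁) :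
    -- the functional takes values in `(-∞, ∞]` on states
    (∀ ρ : H₁ →L[ℂ] H₁, MeasChannel.IsState ρ → ⊥ < MeasChannel.convexClosure μ₁ m₁ ρ) ∧
    -- convexity
    (∀ ρ σ : H₁ →L[ℂ] H₁, MeasChannel.IsState ρ → MeasChannel.IsState σ →
      ∀ t : ℝ, 0 ≤ t → t ≤ 1 →
        MeasChannel.convexClosure μ₁ m₁ (t • ρ + (1 - t) • σ) ≤
          (t : EReal) * MeasChannel.convexClosure μ₁ m₁ ρ +
            ((1 - t : ℝ) : EReal) * MeasChannel.convexClosure μ₁ m₁ σ) ∧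
    -- lower semicontinuity on the set of states with respect to the trace norm
    (∀ ρ : H₁ →L[ℂ] H₁, MeasChannel.IsState ρ →
      ∀ c : EReal, c < MeasChannel.convexClosure μ₁ m₁ ρ →
        ∃ δ : ENNReal, 0 < δ ∧ ∀ σ : H₁ →L[ℂ] H₁, MeasChannel.IsState σ →
          MeasChannel.traceNorm (σ - ρ) < δ → c < MeasChannel.convexClosure μ₁ m₁ σ) ∧
    ∀ {H₂ Y₂ : Type*}
      [NormedAddCommGroup H₂] [InnerProductSpace ℂ H₂] [CompleteSpace H₂]
      [TopologicalSpace.SeparableSpace H₂]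
      [MeasurableSpace Y₂] [StandardBorelSpace Y₂]
      (μ₂ : MeasureTheory.Measure Y₂) [MeasureTheory.SigmaFinite μ₂]
      (m₂ : Y₂ → H₂ →L[ℂ] H₂) (b₂ : ℝ), MeasChannel.IsPOVMDensity μ₂ m₂ b₂ →
      -- strong superadditivity
      (∀ ρ₁₂ : MeasChannel.HTensor H₁ H₂ →L[ℂ] MeasChannel.HTensor H₁ H₂,
        MeasChannel.IsState ρ₁₂ →
          MeasChannel.convexClosure μ₁ m₁ (MeasChannel.partialTraceSnd ρ₁₂) +
              MeasChannel.convexClosure μ₂ m₂ (MeasChannel.partialTraceFst ρ₁₂) ≤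
            MeasChannel.convexClosure (μ₁.prod μ₂) (MeasChannel.prodDensity m₁ m₂) ρ₁₂) ∧
      -- additivity on product states
      (∀ (ρ₁ : H₁ →L[ℂ] H₁) (ρ₂ : H₂ →L[ℂ] H₂),
        MeasChannel.IsState ρ₁ → MeasChannel.IsState ρ₂ →
          MeasChannel.convexClosure (μ₁.prod μ₂) (MeasChannel.prodDensity m₁ m₂)
              (MeasChannel.opTensor ρ₁ ρ₂) =
            MeasChannel.convexClosure μ₁ m₁ ρ₁ + MeasChannel.convexClosure μ₂ m₂ ρ₂) := by
  -- A larger bound is still a bound, and `b ≥ 1` makes `log b` nonnegative.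
  have hb₁ : 1 ≤ max b₁ 1 := le_max_right _ _
  have h₁ := hm₁.mono (le_max_left b₁ 1)
  refine ⟨fun ρ _ => ?_, fun ρ σ hρ hσ t h0 h1 => ?_, fun ρ hρ c hc =>
    h₁.lowerSemicontinuous_convexClosure hb₁ hρ hc, ?_⟩
  · rw [h₁.convexClosure_eq hb₁, bot_lt_iff_ne_bot, sub_eq_add_neg, ← EReal.coe_neg,
      Ne, EReal.add_eq_bot_iff]
    simp [-EReal.coe_neg]
  · rw [h₁.convexClosure_eq hb₁, h₁.convexClosure_eq hb₁, h₁.convexClosure_eq hb₁,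
      ← MeasChannel.ereal_convex_sub h0 h1]
    exact EReal.sub_le_sub (EReal.coe_ennreal_le_coe_ennreal_iff.2
      (h₁.shiftedClosure_convex hρ.isPositive hσ.isPositive h0 h1)) le_rfl
  · intro H₂ Y₂ _ _ _ _ _ _ μ₂ _ m₂ b₂ hm₂
    have hb₂ : 1 ≤ max b₂ 1 := le_max_right _ _
    have h₂ := hm₂.mono (le_max_left b₂ 1)
    have hb : 1 ≤ max b₁ 1 * max b₂ 1 := one_le_mul_of_one_le_of_one_le hb₁ hb₂
    have hlog : Real.log (max b₁ 1 * max b₂ 1) =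
        Real.log (max b₁ 1) + Real.log (max b₂ 1) :=
      Real.log_mul (by positivity) (by positivity)
    have hsuper : ∀ ρ₁₂ : MeasChannel.HTensor H₁ H₂ →L[ℂ] MeasChannel.HTensor H₁ H₂,
        MeasChannel.IsState ρ₁₂ →
          MeasChannel.convexClosure μ₁ m₁ (MeasChannel.partialTraceSnd ρ₁₂) +
              MeasChannel.convexClosure μ₂ m₂ (MeasChannel.partialTraceFst ρ₁₂) ≤
            MeasChannel.convexClosure (μ₁.prod μ₂) (MeasChannel.prodDensity m₁ m₂) ρ₁₂ := by
      intro ρ₁₂ hρ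
      rw [h₁.convexClosure_eq hb₁, h₂.convexClosure_eq hb₂, (h₁.prod h₂).convexClosure_eq hb,
        hlog, ← MeasChannel.ereal_add_sub_add]
      exact EReal.sub_le_sub (EReal.coe_ennreal_le_coe_ennreal_iff.2
        (h₁.shiftedClosure_superadditive hb₁ hb₂ h₂ hρ)) le_rfl
    refine ⟨hsuper, fun ρ₁ ρ₂ hρ₁ hρ₂ => le_antisymm ?_ ?_⟩
    · rw [h₁.convexClosure_eq hb₁, h₂.convexClosure_eq hb₂, (h₁.prod h₂).convexClosure_eq hb,
        hlog, ← MeasChannel.ereal_add_sub_add]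
      exact EReal.sub_le_sub (EReal.coe_ennreal_le_coe_ennreal_iff.2
        (h₁.shiftedClosure_opTensor_le hb₁ hb₂ h₂ hρ₁ hρ₂)) le_rfl
    · simpa only [MeasChannel.partialTraceSnd_opTensor hρ₁ hρ₂,
        MeasChannel.partialTraceFst_opTensor hρ₁ hρ₂] using
        hsuper (MeasChannel.opTensor ρ₁ ρ₂) (hρ₁.opTensor hρ₂)
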